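/- Let $N\ge 1$, let $\mathbb D$ be the open unit ball of $\mathbb R^{N+1}$ with the hyperbolic metric $d$ (Poincaré ball model), $\mathbb S=\partial\mathbb D$ and $\overline{\mathbb D}=\mathbb D\cup\mathbb S$. Let $\mathrm{Con}(N)$ be the group of orientation-preserving isometries of $(\mathbb D,d)$, extended continuously to $\overline{\mathbb D}$. For $g\in\mathrm{Con}(N)$ and $z\in\overline{\mathbb D}$ put $$j(g,z)=\frac{1-|a|^2}{1-2\langle z,a\rangle+|z|^2|a|^2},\qquad a=g^{-1}(0),$$ which is the conformal derivative of $g$ at $z$. **The groups.** Let $\phi:\mathbb N\to[2,\infty)$. Let $C_n^{+},C_n^{-}$ ($n\in\mathbb N$) be open discs in $\mathbb S$ such that, for each $n$, $C_n^+$ and $C_n^-$ have the same (Euclidean, i.e. chordal) radius $r_n\in(0,1)$, and such that the concentric discs $C_n^{\pm,\phi}$ of radii $\phi(n)r_n$ are pairwise disjoint (for all indices $n$ and both signs). Let $g_n\in \mathrm{Con}(N)$ satisfy $g_n(\mathrm{Ext}(C_n^+))=C_n^-$ and $g_n^{-1}(\mathrm{Ext}(C_n^-))=C_n^+$, where $\mathrm{Ext}$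 denotes the exterior in $\mathbb S$, and let $G^{\phi}$ be the group generated by $\{g_n: n\in\mathbb N\}$. **Limit points.** For a subgroup $G$ of $\mathrm{Con}(N)$ let $L(G)=\overline{G(0)}\setminus G(0)$. Let $L_J(G)$ be the set of $\xi\in L(G)$ for which some geodesic ray towards $\xi$ is contained in some Dirichlet fundamental domain $F=\{x\in\mathbb D: d(x,w)<d(x,g(w))\ \forall g\in G\setminus\{1\}\}$ of $G$, where $w\in\mathbb D$ is fixed by no non-trivial element of $G$. Let $L_J'(G^\phi)$ be the set of points of $L_J(G^\phi)$ that lie in $\mathrm{Ext}(C_n^{\pm,\phi})$ for all $n$ and both signs. **Ending measures.** Let $s>0$ be such that $P(z,s)=\sum_{g\in G}j(g,z)^s<\infty$ for all $z\in\mathbb D$, and let $\zeta\in\mathbb S$. An $s$-conformal ending measure of $G$ associated with $\zeta$ is a Borel probability measure on $\overline{\mathbb D}$ that is a weak limit, along a subsequence, of the measures $$\mu_n=\frac1{P(z_n,s)}\sum_{g\in G}j(g,z_n)^s\,\mathbf 1_{g(z_n)},$$ where $\mathbf 1_x$ is the unit point mass at $x$ and $(z_n)$ is a sequence in some Dirichlet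 fundamental domain $F$ of $G$ that tends to $\zeta$ in the Euclidean metric and stays within bounded hyperbolic distance of some geodesic ray towards $\zeta$ contained in $F$. **Proposition.** Let $s>0$ and let $\phi_s:\mathbb N\to[2,\infty)$ be an increasing function with $\sum_{n}(4/\phi_s(n))^{2s}<1/2$. Let $G^{\phi_s}$ be a group as above with $\phi=\phi_s$, and let $\zeta\in L_J'(G^{\phi_s})$. Then the horospherical Poincaré series $\sum_{g\in G^{\phi_s}}j(g,\zeta)^s$ converges. Moreover, $s$-conformal ending measures of $G^{\phi_s}$ associated with $\zeta$ exist, and every such measure $\mu$ is $s$-conformal, i.e. $\mu(g(A))=\int_A j(g,z)^s\,d\mu(z)$ for all $g\in G^{\phi_s}$ and all measurable $A\subseteq\overline{\mathbb D}$, is purely atomic, and has essential support equal to the orbit $G^{\phi_s}(\zeta)$: $\mu(\overline{\mathbb D}\setminus G^{\phi_s}(\zeta))=0$ and $\mu(\{x\})>0$ for every $x\in G^{\phi_s}(\zeta)$. -/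

import Mathlib

/-- The Euclidean space of dimension `N + 1`. -/
abbrev Euc (N : ℕ) : Type := EuclideanSpace ℝ (Fin (N + 1))

/-- The closed unit ball, i.e. hyperbolic space together with its boundary sphere. -/
abbrev ClosedUnitBall (N : ℕ) : Type := Metric.closedBall (0 : Euc N) 1

/-- The open unit ball: the Poincaré ball model of `(N + 1)`-dimensional hyperbolic space. -/
def hypBall (N : ℕ) : Set (ClosedUnitBall N) := {x | ‖(x : Euc N)‖ < 1}

/-- The boundary sphere of dimension `N`. -/
def bdSphere (N : ℕ) : Set (ClosedUnitBall N) := {x | ‖(x : Euc N)‖ = 1}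

/-- The origin of the ball model. -/
def origin (N : ℕ) : ClosedUnitBall N := ⟨0, by simp⟩

/-- The hyperbolic distance (curvature `-1`) of the Poincaré ball model, meaningful for points of
the open ball: `sinh² (d / 2) = |x - y|² / ((1 - |x|²) (1 - |y|²))`. -/
noncomputable def hypDist {N : ℕ} (x y : ClosedUnitBall N) : ℝ :=
  2 * Real.arsinh (‖(x : Euc N) - (y : Euc N)‖ /
    Real.sqrt ((1 - ‖(x : Euc N)‖ ^ 2) * (1 - ‖(y : Euc N)‖ ^ 2)))

open Classical in
/-- A self-map of the closed ball, viewed as a map on the ambient Euclidean space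
(only its germs at points of the open ball are used). -/
noncomputable def ambient {N : ℕ} (g : ClosedUnitBall N ≃ₜ ClosedUnitBall N) (x : Euc N) : Euc N :=
  if h : x ∈ Metric.closedBall (0 : Euc N) 1 then (g ⟨x, h⟩ : Euc N) else x

theorem ambient_coe {N : ℕ} (g : ClosedUnitBall N ≃ₜ ClosedUnitBall N) (x : ClosedUnitBall N) :
    ambient g (x : Euc N) = (g x : Euc N) := by
  have h : (x : Euc N) ∈ Metric.closedBall (0 : Euc N) 1 := x.2
  simp only [ambient, dif_pos h]

theorem hypBall_mem_nhds {N : ℕ} {x : ClosedUnitBall N} (hx : x ∈ hypBall N) :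
    Metric.closedBall (0 : Euc N) 1 ∈ nhds (x : Euc N) := by
  apply Metric.closedBall_mem_nhds_of_mem
  simpa [hypBall] using hx

theorem ambient_differentiableAt {N : ℕ} {g : ClosedUnitBall N ≃ₜ ClosedUnitBall N} {x : Euc N}
    (h : 0 < (fderiv ℝ (ambient g) x).det) : DifferentiableAt ℝ (ambient g) x := by
  by_contra hd
  rw [fderiv_zero_of_not_differentiableAt hd] at h
  simp [ContinuousLinearMap.det] at h

/-- The group of orientation-preserving hyperbolic isometries of the ball model, each of
them together with its continuous extension to the boundary sphere (on which it acts as a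
conformal automorphism). -/
noncomputable def confGroup (N : ℕ) : Subgroup (ClosedUnitBall N ≃ₜ ClosedUnitBall N) where
  carrier := {g | (∀ x, g x ∈ hypBall N ↔ x ∈ hypBall N) ∧
    (∀ x ∈ hypBall N, ∀ y ∈ hypBall N, hypDist (g x) (g y) = hypDist x y) ∧
    (∀ x ∈ hypBall N, 0 < (fderiv ℝ (ambient g) (x : Euc N)).det)}
  one_mem' := by
    refine ⟨fun x => Iff.rfl, fun x _ y _ => rfl, fun x _ => ?_⟩
    have h : ambient (1 : ClosedUnitBall N ≃ₜ ClosedUnitBall N) = id := by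
      funext y
      unfold ambient
      split_ifs <;> rfl
    rw [h, fderiv_id]
    simp [ContinuousLinearMap.det]
  mul_mem' := by
    rintro g h ⟨hg1, hg2, hg3⟩ ⟨hh1, hh2, hh3⟩
    refine ⟨fun x => (hg1 _).trans (hh1 x),
      fun x hx y hy => (hg2 _ ((hh1 x).2 hx) _ ((hh1 y).2 hy)).trans (hh2 x hx y hy),
      fun x hx => ?_⟩
    have e : ambient (g * h) =ᶠ[nhds (x : Euc N)] ambient g ∘ ambient h := by
      filter_upwards [hypBall_mem_nhds hx] with y hy
      have h1 := ambient_coe (g * h) ⟨y, hy⟩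
      have h2 := ambient_coe h ⟨y, hy⟩
      have h3 := ambient_coe g (h ⟨y, hy⟩)
      simp only at h1 h2
      rw [Function.comp_apply, h1, h2, h3]
      rfl
    have dh := hh3 x hx
    have dg := hg3 (h x) ((hh1 x).2 hx)
    rw [← ambient_coe h x] at dg
    rw [e.fderiv_eq, fderiv_comp _ (ambient_differentiableAt dg) (ambient_differentiableAt dh)]
    simp only [ContinuousLinearMap.det, ContinuousLinearMap.toLinearMap_comp, LinearMap.det_comp]
      at dg dh ⊢
    exact mul_pos dg dh
  inv_mem' := by
    rintro g ⟨hg1, hg2, hg3⟩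
    have gi : ∀ x, g (g⁻¹ x) = x := fun x => g.apply_symm_apply x
    have k1 : ∀ x, g⁻¹ x ∈ hypBall N ↔ x ∈ hypBall N := fun x => by
      rw [← hg1, gi]
    refine ⟨k1, fun x hx y hy => ?_, fun x hx => ?_⟩
    · rw [← hg2 _ ((k1 x).2 hx) _ ((k1 y).2 hy), gi, gi]
    · have dg := hg3 (g⁻¹ x) ((k1 x).2 hx)
      have hd := (ambient_differentiableAt dg).hasFDerivAt
      rw [← ambient_coe g⁻¹ x] at dg hd
      set A := fderiv ℝ (ambient g) (ambient g⁻¹ (x : Euc N)) with hA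
      let e : Euc N ≃L[ℝ] Euc N := ContinuousLinearMap.toContinuousLinearEquivOfDetNeZero A dg.ne'
      have he : (e : Euc N →L[ℝ] Euc N) = A := by
        ext v
        simp [e]
      have hc : ContinuousAt (ambient g⁻¹) (x : Euc N) := by
        have c1 : ContinuousOn (ambient g⁻¹) (Metric.closedBall (0 : Euc N) 1) := by
          rw [continuousOn_iff_continuous_domRestrict]
          have : (Metric.closedBall (0 : Euc N) 1).domRestrict (ambient g⁻¹)
              = fun y => ((g⁻¹ y : ClosedUnitBall N) : Euc N) := by
            funext y
            exact ambient_coe g⁻¹ y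
          rw [this]
          exact continuous_subtype_val.comp (g⁻¹).continuous
        exact c1.continuousAt (hypBall_mem_nhds hx)
      have hi : ∀ᶠ y in nhds (x : Euc N), ambient g (ambient g⁻¹ y) = y := by
        filter_upwards [hypBall_mem_nhds hx] with y hy
        have h2 := ambient_coe g⁻¹ ⟨y, hy⟩
        simp only at h2
        rw [h2, ambient_coe, gi]
      rw [← he] at hd
      have hinv := HasFDerivAt.of_local_left_inverse hc hd hi
      rw [hinv.fderiv]
      have hmul : ((e.symm : Euc N →L[ℝ] Euc N)).det * A.det = 1 := by
        rw [← he]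
        have : ((e.symm : Euc N →L[ℝ] Euc N)) ∘L (e : Euc N →L[ℝ] Euc N)
            = ContinuousLinearMap.id ℝ (Euc N) := by
          ext v
          simp
        have h4 := congrArg ContinuousLinearMap.det this
        have h5 : (ContinuousLinearMap.id ℝ (Euc N)).det = 1 := by
          simp [ContinuousLinearMap.det]
        rw [h5] at h4
        simpa only [ContinuousLinearMap.det, ContinuousLinearMap.toLinearMap_comp,
          LinearMap.det_comp] using h4
      have : 0 < ((e.symm : Euc N →L[ℝ] Euc N)).det * A.det := by
        rw [hmul]
        exact one_pos
      exact pos_of_mul_pos_left this dg.le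

/-- The conformal derivative `j (g, z) = (1 - |a|²) / (|z* - a|² |z|²)` with `a = g⁻¹ (0)` and
`z*` the reflection of `z` in the unit sphere. The denominator is written out as
`1 - 2 ⟪z, a⟫ + |z|² |a|²`, so that the formula also covers `z = 0`; for `|z| = 1` it is
`|z - a|²`. -/
noncomputable def confDeriv {N : ℕ} (g : ClosedUnitBall N ≃ₜ ClosedUnitBall N)
    (z : ClosedUnitBall N) : ℝ :=
  (1 - ‖(g⁻¹ (origin N) : Euc N)‖ ^ 2) /
    (1 - 2 * inner ℝ (z : Euc N) (g⁻¹ (origin N) : Euc N)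
      + ‖(z : Euc N)‖ ^ 2 * ‖(g⁻¹ (origin N) : Euc N)‖ ^ 2)

/-- The orbit `G (z)`. -/
def groupOrbit {N : ℕ} (G : Subgroup (ClosedUnitBall N ≃ₜ ClosedUnitBall N))
    (z : ClosedUnitBall N) : Set (ClosedUnitBall N) :=
  {x | ∃ g ∈ G, g z = x}

/-- The limit set: the accumulation set `closure (G (0)) \ G (0)` of the orbit of the origin. -/
def limitSet {N : ℕ} (G : Subgroup (ClosedUnitBall N ≃ₜ ClosedUnitBall N)) :
    Set (ClosedUnitBall N) :=
  closure (groupOrbit G (origin N)) \ groupOrbit G (origin N)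

/-- `w` is an admissible centre of a Dirichlet fundamental domain of `G`: a point of the open ball
fixed by no non-trivial element of `G`. -/
def IsDirichletCentre {N : ℕ} (G : Subgroup (ClosedUnitBall N ≃ₜ ClosedUnitBall N))
    (w : ClosedUnitBall N) : Prop :=
  w ∈ hypBall N ∧ ∀ g ∈ G, g w = w → g = 1

/-- The Dirichlet fundamental domain of `G` with centre `w`. -/
def dirichletDomain {N : ℕ} (G : Subgroup (ClosedUnitBall N ≃ₜ ClosedUnitBall N))
    (w : ClosedUnitBall N) : Set (ClosedUnitBall N) :=
  {x | x ∈ hypBall N ∧ ∀ g ∈ G, g ≠ 1 → hypDist x w < hypDist x (g w)}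

/-- `γ`, restricted to `[0, ∞)`, is a hyperbolic geodesic ray (parametrised by arc length)
towards the boundary point `ζ`. -/
def IsGeodesicRay {N : ℕ} (γ : ℝ → ClosedUnitBall N) (ζ : ClosedUnitBall N) : Prop :=
  (∀ t, 0 ≤ t → γ t ∈ hypBall N) ∧
  (∀ t u, 0 ≤ t → 0 ≤ u → hypDist (γ t) (γ u) = |t - u|) ∧
  ζ ∈ bdSphere N ∧ Filter.Tendsto γ Filter.atTop (nhds ζ)

/-- The set of Jørgensen limit points: limit points towards which there is a geodesic ray that is
fully contained in some Dirichlet fundamental domain. -/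
def jorgensenSet {N : ℕ} (G : Subgroup (ClosedUnitBall N ≃ₜ ClosedUnitBall N)) :
    Set (ClosedUnitBall N) :=
  {ξ | ξ ∈ limitSet G ∧ ∃ w, IsDirichletCentre G w ∧ ∃ γ, IsGeodesicRay γ ξ ∧
    ∀ t, 0 ≤ t → γ t ∈ dirichletDomain G w}

/-- `z` is an ending sequence tending to `ζ` inside the Dirichlet fundamental domain of `G` with
centre `w`: all `z n` lie in the domain, within bounded hyperbolic distance of a geodesic ray
towards `ζ` contained in the domain, and `z n` tends to `ζ` in the Euclidean metric. -/
def IsEndingSequence {N : ℕ} (G : Subgroup (ClosedUnitBall N ≃ₜ ClosedUnitBall N))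
    (w ζ : ClosedUnitBall N) (z : ℕ → ClosedUnitBall N) : Prop :=
  (∀ n, z n ∈ dirichletDomain G w) ∧
  (∃ γ, IsGeodesicRay γ ζ ∧ (∀ t, 0 ≤ t → γ t ∈ dirichletDomain G w) ∧
    ∃ C : ℝ, ∀ n, ∃ t, 0 ≤ t ∧ hypDist (z n) (γ t) ≤ C) ∧
  Filter.Tendsto z Filter.atTop (nhds ζ)

/-- The series `∑ j (g, z) ^ s` over `g ∈ G` converges: for `z` in the open ball this is the
Poincaré series, for `z` on the boundary sphere the horospherical Poincaré series. -/
def PoincareConverges {N : ℕ} (G : Subgroup (ClosedUnitBall N ≃ₜ ClosedUnitBall N))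
    (z : ClosedUnitBall N) (s : ℝ) : Prop :=
  Summable fun g : G => confDeriv (g : ClosedUnitBall N ≃ₜ ClosedUnitBall N) z ^ s

/-- The normalised orbit measure
`(∑ j (g, z) ^ s)⁻¹ ∑ j (g, z) ^ s • δ_{g (z)}`, both sums over `g ∈ G`. -/
noncomputable def orbitMeasure {N : ℕ} (G : Subgroup (ClosedUnitBall N ≃ₜ ClosedUnitBall N))
    (s : ℝ) (z : ClosedUnitBall N) : MeasureTheory.Measure (ClosedUnitBall N) :=
  (∑' g : G, ENNReal.ofReal (confDeriv (g : ClosedUnitBall N ≃ₜ ClosedUnitBall N) z ^ s))⁻¹ •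
    MeasureTheory.Measure.sum fun g : G =>
      ENNReal.ofReal (confDeriv (g : ClosedUnitBall N ≃ₜ ClosedUnitBall N) z ^ s) •
        MeasureTheory.Measure.dirac ((g : ClosedUnitBall N ≃ₜ ClosedUnitBall N) z)

/-- `μ` is an ending measure of exponent `s` for `G` associated to `ζ`: the Poincaré series of `G`
converges at `s`, and `μ` is a probability measure on the closed ball that is the weak limit, along
a subsequence, of the normalised orbit measures of some ending sequence tending to `ζ`. -/
def IsEndingMeasure {N : ℕ} (G : Subgroup (ClosedUnitBall N ≃ₜ ClosedUnitBall N)) (s : ℝ)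
    (ζ : ClosedUnitBall N) (μ : MeasureTheory.Measure (ClosedUnitBall N)) : Prop :=
  (∀ z ∈ hypBall N, PoincareConverges G z s) ∧ MeasureTheory.IsProbabilityMeasure μ ∧
  ∃ w z, IsDirichletCentre G w ∧ IsEndingSequence G w ζ z ∧
    ∃ k : ℕ → ℕ, StrictMono k ∧ ∀ f : C(ClosedUnitBall N, ℝ),
      Filter.Tendsto (fun n => ∫ x, f x ∂(orbitMeasure G s (z (k n)))) Filter.atTop
        (nhds (∫ x, f x ∂μ))

/-- The probability measure `μ` on the closed ball is `s`-conformal for `G`. -/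
def IsConformalMeasure {N : ℕ} (G : Subgroup (ClosedUnitBall N ≃ₜ ClosedUnitBall N)) (s : ℝ)
    (μ : MeasureTheory.Measure (ClosedUnitBall N)) : Prop :=
  MeasureTheory.IsProbabilityMeasure μ ∧
  ∀ g ∈ G, ∀ A : Set (ClosedUnitBall N), MeasurableSet A →
    μ (g '' A) = ∫⁻ z in A, ENNReal.ofReal (confDeriv g z ^ s) ∂μ

/-- Every measurable set of positive measure contains a point of positive mass. -/
def IsPurelyAtomic {X : Type*} [MeasurableSpace X] (μ : MeasureTheory.Measure X) : Prop :=
  ∀ A : Set X, MeasurableSet A → 0 < μ A → ∃ x ∈ A, 0 < μ {x}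

/-- The open disc in the boundary sphere with centre `c` and radius `r`, measured in the Euclidean
(chordal) metric. -/
def bdDisc {N : ℕ} (c : ClosedUnitBall N) (r : ℝ) : Set (ClosedUnitBall N) :=
  {x | x ∈ bdSphere N ∧ dist x c < r}

/-- The exterior, in the boundary sphere, of the disc with centre `c` and radius `r`, i.e. the
complement of the closed disc. -/
def bdExt {N : ℕ} (c : ClosedUnitBall N) (r : ℝ) : Set (ClosedUnitBall N) :=
  {x | x ∈ bdSphere N ∧ r < dist x c}

/-- The data defining an infinitely generated classical Schottky group with enlargement
function `φ`: discs `C n ε` (`ε = true` stands for `+` and `ε = false` for `-`) in the boundary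
sphere, with radii `r n < 1` and such that the concentric discs of radii `φ n * r n` are pairwise
disjoint, and, for each `n`, a transformation `g n` mapping the exterior of `C n +` onto `C n -`
and whose inverse maps the exterior of `C n -` onto `C n +`. -/
structure SchottkyData (N : ℕ) (φ : ℕ → ℝ) where
  centre : ℕ → Bool → ClosedUnitBall N
  centre_mem : ∀ n ε, centre n ε ∈ bdSphere N
  radius : ℕ → ℝ
  radius_pos : ∀ n, 0 < radius n
  radius_lt_one : ∀ n, radius n < 1
  disjoint_enlarged : ∀ n m : ℕ, ∀ ε ε' : Bool, (n, ε) ≠ (m, ε') →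
    Disjoint (bdDisc (centre n ε) (φ n * radius n)) (bdDisc (centre m ε') (φ m * radius m))
  gen : ℕ → ClosedUnitBall N ≃ₜ ClosedUnitBall N
  gen_mem : ∀ n, gen n ∈ confGroup N
  gen_image : ∀ n, gen n '' bdExt (centre n true) (radius n) = bdDisc (centre n false) (radius n)
  gen_inv_image : ∀ n,
    (gen n).symm '' bdExt (centre n false) (radius n) = bdDisc (centre n true) (radius n)

/-- The infinitely generated Schottky group `G^φ`. -/
def SchottkyData.group {N : ℕ} {φ : ℕ → ℝ} (S : SchottkyData N φ) :
    Subgroup (ClosedUnitBall N ≃ₜ ClosedUnitBall N) :=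
  Subgroup.closure (Set.range S.gen)

theorem SchottkyData.group_le {N : ℕ} {φ : ℕ → ℝ} (S : SchottkyData N φ) : S.group ≤ confGroup N := by
  rw [SchottkyData.group, Subgroup.closure_le]
  rintro _ ⟨n, rfl⟩
  exact S.gen_mem n

/-- The set `L_J'` of those Jørgensen limit points which lie in the exterior of every enlarged
disc. -/
def SchottkyData.jorgensenSet' {N : ℕ} {φ : ℕ → ℝ} (S : SchottkyData N φ) :
    Set (ClosedUnitBall N) :=
  jorgensenSet S.group ∩ ⋂ (n : ℕ) (ε : Bool), bdExt (S.centre n ε) (φ n * S.radius n)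

open Filter Topology

/-! ### Distortion identities for hyperbolic isometries, up to the boundary. -/

section ConformalDistortion

variable {N : ℕ}

/-! The weak limit can be computed explicitly. Once the horospherical series converges at `ζ`, every
ending measure equals `orbitMeasure G s ζ`, the normalised sum of the masses `j (g, ζ) ^ s` at the
points `g (ζ)`. For this measure conformality is the chain rule plus a reindexing of the group, and
atomicity and support are visible from the formula.

Convergence at `ζ` is a ping-pong argument. If `g` maps the exterior of a disc of radius `r` onto a
disc of the same radius, then `a = g⁻¹ (0)` satisfies `1 - |a|² < r²` and `|a - c| ≤ r`
(`preimage_origin_of_image_bdExt`). Hence `j (g, x) ≤ (2 / q)²` at boundary points at distance at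
least `q r` from `c` (`confDeriv_le_of_far`). For `ζ` outside all enlarged discs, each letter of a
reduced word is applied at a point outside the enlarged disc of that letter, so `j ^ s` of the word
is at most the product of the letter weights (`SchottkyData.word_estimate`). Summing over all words
gives a geometric series with ratio below `1`.

The passage to the limit is dominated convergence, with domination `j (g, z n) ≤ K j (g, ζ)` uniform
in `g` (`IsEndingSequence.exists_confDeriv_le`). It has two sources: `z n` approaches `ζ`
non-tangentially, being at bounded distance from a ray, and `j (g, z n)` is bounded because `z n`
lies in a Dirichlet domain whose centre is away from `ζ`. -/

theorem dense_hypBall (N : ℕ) : Dense (hypBall N) := by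
  rw [Subtype.dense_iff]
  intro x hx
  have h : Subtype.val '' (hypBall N) = Metric.ball (0 : Euc N) 1 := by
    ext y
    simp only [Set.mem_image, mem_ball_zero_iff]
    constructor
    · rintro ⟨x, hx, rfl⟩
      exact hx
    · intro hy
      exact ⟨⟨y, by simpa using hy.le⟩, hy, rfl⟩
  rw [h, closure_ball _ one_ne_zero]
  exact hx

theorem norm_coe_le_one (x : ClosedUnitBall N) : ‖(x : Euc N)‖ ≤ 1 :=
  mem_closedBall_zero_iff.1 x.2

theorem origin_mem_hypBall : origin N ∈ hypBall N := by
  simp [hypBall, origin]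

theorem one_sub_norm_sq_pos {x : ClosedUnitBall N} (hx : x ∈ hypBall N) :
    0 < 1 - ‖(x : Euc N)‖ ^ 2 := by
  have h : ‖(x : Euc N)‖ < 1 := hx
  nlinarith [norm_nonneg (x : Euc N)]

/-- The denominator of the conformal derivative. -/
noncomputable def confDenom (z a : Euc N) : ℝ := 1 - 2 * inner ℝ z a + ‖z‖ ^ 2 * ‖a‖ ^ 2

/-- Divided by `(1 - |z|²) (1 - |a|²)`, this is the relation `cosh² = sinh² + 1` for half the
hyperbolic distance. -/
theorem confDenom_eq (z a : Euc N) :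
    confDenom z a = ‖z - a‖ ^ 2 + (1 - ‖z‖ ^ 2) * (1 - ‖a‖ ^ 2) := by
  rw [confDenom, norm_sub_sq_real]
  ring

theorem sq_one_sub_mul_le_confDenom (z a : Euc N) : (1 - ‖z‖ * ‖a‖) ^ 2 ≤ confDenom z a := by
  have := real_inner_le_norm z a
  rw [confDenom]
  nlinarith

theorem confDenom_pos {z a : Euc N} (hz : ‖z‖ ≤ 1) (ha : ‖a‖ < 1) : 0 < confDenom z a := by
  refine lt_of_lt_of_le ?_ (sq_one_sub_mul_le_confDenom z a)
  have : ‖z‖ * ‖a‖ < 1 := by nlinarith [norm_nonneg z, norm_nonneg a]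
  have : 0 < 1 - ‖z‖ * ‖a‖ := by linarith
  positivity

theorem confDenom_le_four {z a : Euc N} (hz : ‖z‖ ≤ 1) (ha : ‖a‖ ≤ 1) : confDenom z a ≤ 4 := by
  have h1 := neg_le_of_abs_le (abs_real_inner_le_norm z a)
  have h3 : ‖z‖ * ‖a‖ ≤ 1 := by nlinarith [norm_nonneg z, norm_nonneg a]
  have h4 : 0 ≤ ‖z‖ * ‖a‖ := by positivity
  rw [confDenom]
  nlinarith

theorem hypDist_nonneg (x y : ClosedUnitBall N) : 0 ≤ hypDist x y := by
  unfold hypDist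
  have : 0 ≤ ‖(x : Euc N) - (y : Euc N)‖ /
    Real.sqrt ((1 - ‖(x : Euc N)‖ ^ 2) * (1 - ‖(y : Euc N)‖ ^ 2)) := by positivity
  have := Real.arsinh_nonneg_iff.2 this
  positivity

theorem sinh_half_hypDist_sq {x y : ClosedUnitBall N} (hx : x ∈ hypBall N) (hy : y ∈ hypBall N) :
    Real.sinh (hypDist x y / 2) ^ 2 =
      ‖(x : Euc N) - (y : Euc N)‖ ^ 2 / ((1 - ‖(x : Euc N)‖ ^ 2) * (1 - ‖(y : Euc N)‖ ^ 2)) := by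
  unfold hypDist
  rw [mul_div_cancel_left₀ _ two_ne_zero, Real.sinh_arsinh, div_pow, Real.sq_sqrt]
  exact (mul_pos (one_sub_norm_sq_pos hx) (one_sub_norm_sq_pos hy)).le

theorem sinh_half_hypDist_sq_le {x y x' y' : ClosedUnitBall N}
    (h : hypDist x y ≤ hypDist x' y') :
    Real.sinh (hypDist x y / 2) ^ 2 ≤ Real.sinh (hypDist x' y' / 2) ^ 2 := by
  have h0 := hypDist_nonneg x y
  refine pow_le_pow_left₀ (Real.sinh_nonneg_iff.2 (by linarith)) (Real.sinh_le_sinh.2 ?_) 2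
  linarith

theorem confDeriv_eq (g : ClosedUnitBall N ≃ₜ ClosedUnitBall N) (z : ClosedUnitBall N) :
    confDeriv g z = (1 - ‖(g⁻¹ (origin N) : Euc N)‖ ^ 2) /
      confDenom (z : Euc N) (g⁻¹ (origin N) : Euc N) := rfl

theorem confGroup_mem_hypBall_iff {g : ClosedUnitBall N ≃ₜ ClosedUnitBall N}
    (hg : g ∈ confGroup N) (x : ClosedUnitBall N) : g x ∈ hypBall N ↔ x ∈ hypBall N := hg.1 x

theorem confGroup_mem_bdSphere {g : ClosedUnitBall N ≃ₜ ClosedUnitBall N}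
    (hg : g ∈ confGroup N) {x : ClosedUnitBall N} (hx : x ∈ bdSphere N) : g x ∈ bdSphere N := by
  have h := confGroup_mem_hypBall_iff hg x
  have hx1 : ‖(x : Euc N)‖ = 1 := hx
  have h1 : ¬ ‖(g x : Euc N)‖ < 1 := fun h' => by
    have : ‖(x : Euc N)‖ < 1 := h.1 h'
    linarith
  exact le_antisymm (norm_coe_le_one _) (not_lt.1 h1)

theorem inv_origin_mem_hypBall {g : ClosedUnitBall N ≃ₜ ClosedUnitBall N}
    (hg : g ∈ confGroup N) : g⁻¹ (origin N) ∈ hypBall N :=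
  (confGroup_mem_hypBall_iff (inv_mem hg) _).2 origin_mem_hypBall

theorem confDenom_inv_origin_pos {g : ClosedUnitBall N ≃ₜ ClosedUnitBall N}
    (hg : g ∈ confGroup N) (z : ClosedUnitBall N) :
    0 < confDenom (z : Euc N) (g⁻¹ (origin N) : Euc N) :=
  confDenom_pos (norm_coe_le_one z) (inv_origin_mem_hypBall hg)

theorem confDeriv_pos {g : ClosedUnitBall N ≃ₜ ClosedUnitBall N}
    (hg : g ∈ confGroup N) (z : ClosedUnitBall N) : 0 < confDeriv g z :=
  div_pos (one_sub_norm_sq_pos (inv_origin_mem_hypBall hg)) (confDenom_inv_origin_pos hg z)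

theorem continuous_confDeriv {g : ClosedUnitBall N ≃ₜ ClosedUnitBall N}
    (hg : g ∈ confGroup N) : Continuous (confDeriv g) := by
  refine Continuous.div (by fun_prop) ?_ (fun z => (confDenom_inv_origin_pos hg z).ne')
  fun_prop

theorem confDeriv_one (z : ClosedUnitBall N) : confDeriv 1 z = 1 := by
  have : ((1 : ClosedUnitBall N ≃ₜ ClosedUnitBall N)⁻¹ (origin N) : Euc N) = 0 := by
    rw [inv_one]
    rfl
  rw [confDeriv, this]
  simp

/-- Comes from `d (g x, 0) = d (x, g⁻¹ 0)`. It lets the algebra of `confDeriv` be derived from the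
isometry property alone, without a classification of Möbius maps. -/
theorem one_sub_norm_sq_map {g : ClosedUnitBall N ≃ₜ ClosedUnitBall N}
    (hg : g ∈ confGroup N) {x : ClosedUnitBall N} (hx : x ∈ hypBall N) :
    1 - ‖(g x : Euc N)‖ ^ 2 = confDeriv g x * (1 - ‖(x : Euc N)‖ ^ 2) := by
  have ha := inv_origin_mem_hypBall hg
  have hgx := (confGroup_mem_hypBall_iff hg x).2 hx
  have h := hg.2.1 x hx _ ha
  have e : g (g⁻¹ (origin N)) = origin N := g.apply_symm_apply _
  rw [e] at h
  have h2 := congrArg (fun t => Real.sinh (t / 2) ^ 2) h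
  rw [sinh_half_hypDist_sq hgx origin_mem_hypBall, sinh_half_hypDist_sq hx ha] at h2
  have e0 : (origin N : Euc N) = 0 := rfl
  rw [e0, sub_zero, norm_zero] at h2
  have p1 := one_sub_norm_sq_pos hgx
  have p2 := one_sub_norm_sq_pos hx
  have p3 := one_sub_norm_sq_pos ha
  have hD := confDenom_inv_origin_pos hg x
  rw [confDeriv_eq, div_mul_eq_mul_div, eq_div_iff hD.ne', confDenom_eq]
  rw [div_eq_div_iff (by positivity) (by positivity)] at h2
  linear_combination -h2

/-- Inside the ball this is invariance of the distance combined with `one_sub_norm_sq_map`; both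
sides are continuous, so density carries it to the sphere. -/
theorem norm_map_sub_map_sq {g : ClosedUnitBall N ≃ₜ ClosedUnitBall N}
    (hg : g ∈ confGroup N) (x y : ClosedUnitBall N) :
    ‖(g x : Euc N) - (g y : Euc N)‖ ^ 2 =
      confDeriv g x * confDeriv g y * ‖(x : Euc N) - (y : Euc N)‖ ^ 2 := by
  have hc := continuous_confDeriv hg
  have hgc : Continuous g := g.continuous
  have key : (fun q : ClosedUnitBall N × ClosedUnitBall N =>
      ‖(g q.1 : Euc N) - (g q.2 : Euc N)‖ ^ 2) = fun q =>
      confDeriv g q.1 * confDeriv g q.2 * ‖(q.1 : Euc N) - (q.2 : Euc N)‖ ^ 2 := by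
    refine Continuous.ext_on ((dense_hypBall N).prod (dense_hypBall N)) (by fun_prop)
      (by fun_prop) ?_
    rintro ⟨x, y⟩ ⟨hx, hy⟩
    simp only at hx hy ⊢
    have hgx := (confGroup_mem_hypBall_iff hg x).2 hx
    have hgy := (confGroup_mem_hypBall_iff hg y).2 hy
    have h2 := congrArg (fun t => Real.sinh (t / 2) ^ 2) (hg.2.1 x hx y hy)
    have p1 := one_sub_norm_sq_pos hx
    have p2 := one_sub_norm_sq_pos hy
    have p3 := confDeriv_pos hg x
    have p4 := confDeriv_pos hg y
    rw [sinh_half_hypDist_sq hgx hgy, sinh_half_hypDist_sq hx hy, one_sub_norm_sq_map hg hx,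
      one_sub_norm_sq_map hg hy, div_eq_div_iff (by positivity) (by positivity)] at h2
    have p5 : 0 < (1 - ‖(x : Euc N)‖ ^ 2) * (1 - ‖(y : Euc N)‖ ^ 2) := by positivity
    refine mul_right_cancel₀ p5.ne' ?_
    linear_combination h2
  exact congrFun key (x, y)

theorem confDeriv_mul {g h : ClosedUnitBall N ≃ₜ ClosedUnitBall N}
    (hg : g ∈ confGroup N) (hh : h ∈ confGroup N) (z : ClosedUnitBall N) :
    confDeriv (g * h) z = confDeriv g (h z) * confDeriv h z := by
  have hgc := continuous_confDeriv hg
  have hhc := continuous_confDeriv hh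
  have hghc := continuous_confDeriv (mul_mem hg hh)
  have hc : Continuous h := h.continuous
  refine congrFun (Continuous.ext_on (dense_hypBall N) hghc
    ((hgc.comp hc).mul hhc) ?_) z
  intro x hx
  have hhx := (confGroup_mem_hypBall_iff hh x).2 hx
  have h1 := one_sub_norm_sq_map (mul_mem hg hh) hx
  have h2 := one_sub_norm_sq_map hg hhx
  have e : (g * h) x = g (h x) := rfl
  rw [e, h2, one_sub_norm_sq_map hh hx] at h1
  refine mul_right_cancel₀ (one_sub_norm_sq_pos hx).ne' ?_
  simp only [Pi.mul_apply, Function.comp_apply]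
  linear_combination -h1

theorem confDeriv_of_mem_bdSphere (g : ClosedUnitBall N ≃ₜ ClosedUnitBall N)
    {z : ClosedUnitBall N} (hz : z ∈ bdSphere N) :
    confDeriv g z = (1 - ‖(g⁻¹ (origin N) : Euc N)‖ ^ 2) /
      ‖(z : Euc N) - (g⁻¹ (origin N) : Euc N)‖ ^ 2 := by
  have h : ‖(z : Euc N)‖ = 1 := hz
  rw [confDeriv_eq, confDenom_eq, h]
  norm_num

end ConformalDistortion

/-! ### Conformal derivative of a single Schottky generator. -/

section SchottkyLetter

variable {N : ℕ}

theorem exists_unit_orthogonal (hN : 1 ≤ N) {c : Euc N} (hc : ‖c‖ = 1) :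
    ∃ u : Euc N, ‖u‖ = 1 ∧ inner ℝ c u = 0 := by
  have hc0 : c ≠ 0 := by
    rintro rfl
    simp at hc
  have : Fact (Module.finrank ℝ (Euc N) = N + 1) := ⟨by simp⟩
  have h1 := Submodule.finrank_orthogonal_span_singleton (𝕜 := ℝ) (n := N) hc0
  have : Nontrivial (Submodule.span ℝ {c})ᗮ := Module.nontrivial_of_finrank_pos (R := ℝ) (by omega)
  obtain ⟨u, hu⟩ := exists_norm_eq (Submodule.span ℝ {c})ᗮ zero_le_one
  exact ⟨u, hu, Submodule.mem_orthogonal_singleton_iff_inner_right.1 u.2⟩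

/-- Two affine functions whose positivity (negativity) sets on the unit sphere agree and cut the
sphere in a proper cap are proportional. -/
theorem affine_proportional (hN : 1 ≤ N) {c v : Euc N} (hc : ‖c‖ = 1) {t τ : ℝ}
    (ht : t ∈ Set.Ioo (-2 : ℝ) 2)
    (h : ∀ x : Euc N, ‖x‖ = 1 → (τ - 2 * inner ℝ x v < 0 ↔ 0 < t - 2 * inner ℝ x c)) :
    v = (inner ℝ c v : ℝ) • c ∧ τ = t * inner ℝ c v := by
  obtain ⟨ht1, ht2⟩ := ht
  set κ : ℝ := inner ℝ c v with hκ
  have hcc : inner ℝ c c = (1 : ℝ) := by rw [real_inner_self_eq_norm_sq, hc, one_pow]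
  -- Test points on the half great circle from `-c` to `c` through `u`, parametrised by their height
  -- `b` over `c`; the cap boundary is at `b = t / 2`.
  have norm_comb : ∀ u : Euc N, ‖u‖ = 1 → inner ℝ c u = (0 : ℝ) → ∀ b : ℝ, b ^ 2 ≤ 1 →
      ‖b • c + Real.sqrt (1 - b ^ 2) • u‖ = 1 := by
    intro u hu hcu b hb
    have : ‖b • c + Real.sqrt (1 - b ^ 2) • u‖ ^ 2 = 1 := by
      rw [norm_add_sq_real, norm_smul, norm_smul, inner_smul_left, inner_smul_right, hcu, hc, hu]
      simp only [mul_one, Real.norm_eq_abs, sq_abs, mul_zero, add_zero]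
      rw [Real.sq_sqrt (by linarith)]
      ring
    exact (pow_eq_one_iff_of_nonneg (norm_nonneg _) two_ne_zero).1 this
  have inner_c : ∀ u : Euc N, inner ℝ c u = (0 : ℝ) → ∀ b : ℝ,
      inner ℝ (b • c + Real.sqrt (1 - b ^ 2) • u) c = b := by
    intro u hcu b
    rw [inner_add_left, inner_smul_left, inner_smul_left, hcc, real_inner_comm, hcu]
    simp
  have inner_v : ∀ u : Euc N, ∀ b : ℝ,
      inner ℝ (b • c + Real.sqrt (1 - b ^ 2) • u) v
        = b * κ + Real.sqrt (1 - b ^ 2) * inner ℝ u v := by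
    intro u b
    rw [inner_add_left, inner_smul_left, inner_smul_left]
    simp [hκ]
  -- The first affine function vanishes on the cap boundary: it is negative for `b < t / 2`, hence
  -- nonpositive in the limit, and it is not negative at `b = t / 2` itself.
  have zero : ∀ u : Euc N, ‖u‖ = 1 → inner ℝ c u = (0 : ℝ) →
      τ - 2 * (t / 2 * κ + Real.sqrt (1 - (t / 2) ^ 2) * inner ℝ u v) = 0 := by
    intro u hu hcu
    apply le_antisymm
    · have hcont : Continuous fun b : ℝ =>
          τ - 2 * (b * κ + Real.sqrt (1 - b ^ 2) * inner ℝ u v) := by fun_prop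
      have hlim := (hcont.tendsto (t / 2)).mono_left (nhdsWithin_le_nhds (s := Set.Iio (t / 2)))
      refine le_of_tendsto hlim ?_
      have hmem : Set.Ioo (-1 : ℝ) (t / 2) ∈ 𝓝[<] (t / 2) := Ioo_mem_nhdsLT (by linarith)
      filter_upwards [hmem] with b hb
      have hb1 : b ^ 2 ≤ 1 := by nlinarith [hb.1, hb.2]
      have := (h _ (norm_comb u hu hcu b hb1)).2 (by rw [inner_c u hcu]; linarith [hb.2])
      rw [inner_v] at this
      exact this.le
    · have hb1 : (t / 2) ^ 2 ≤ 1 := by nlinarith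
      have := mt (h _ (norm_comb u hu hcu (t / 2) hb1)).1 (by rw [inner_c u hcu]; linarith)
      rw [inner_v] at this
      linarith
  have zero' : ∀ u : Euc N, ‖u‖ = 1 → inner ℝ c u = (0 : ℝ) →
      τ = t * κ ∧ inner ℝ u v = (0 : ℝ) := by
    intro u hu hcu
    have h1 := zero u hu hcu
    have h2 := zero (-u) (by rwa [norm_neg]) (by rw [inner_neg_right, hcu, neg_zero])
    rw [inner_neg_left] at h2
    have hs : 0 < Real.sqrt (1 - (t / 2) ^ 2) := Real.sqrt_pos.2 (by nlinarith)
    refine ⟨by linarith, ?_⟩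
    have : Real.sqrt (1 - (t / 2) ^ 2) * inner ℝ u v = 0 := by linarith
    exact (mul_eq_zero.1 this).resolve_left hs.ne'
  obtain ⟨u, hu, hcu⟩ := exists_unit_orthogonal hN hc
  refine ⟨?_, (zero' u hu hcu).1⟩
  by_contra hne
  have hw : v - κ • c ≠ 0 := sub_ne_zero.2 hne
  have hcw : inner ℝ c (v - κ • c) = (0 : ℝ) := by
    rw [inner_sub_right, inner_smul_right, hcc, hκ]
    ring
  have hn : ‖v - κ • c‖ ≠ 0 := norm_ne_zero_iff.2 hw
  have h3 := (zero' (‖v - κ • c‖⁻¹ • (v - κ • c))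
    (by rw [norm_smul, norm_inv, norm_norm, inv_mul_cancel₀ hn])
    (by rw [inner_smul_right, hcw, mul_zero])).2
  rw [real_inner_smul_left] at h3
  have h4 : inner ℝ (v - κ • c) v = (0 : ℝ) := (mul_eq_zero.1 h3).resolve_left (inv_ne_zero hn)
  have h5 : ‖v - κ • c‖ ^ 2 = 0 := by
    rw [← real_inner_self_eq_norm_sq]
    nth_rewrite 2 [sub_eq_add_neg]
    rw [inner_add_right, h4, inner_neg_right, inner_smul_right, real_inner_comm, hcw]
    ring
  exact hn (pow_eq_zero_iff two_ne_zero |>.1 h5)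

/-- If an isometry maps the exterior of a disc onto a disc of the same radius `r`, then the
preimage `a` of the origin satisfies `1 - |a|² < r²` and `|a - c|² = r² - (1 - |a|²)`. -/
theorem preimage_origin_of_image_bdExt (hN : 1 ≤ N) {g : ClosedUnitBall N ≃ₜ ClosedUnitBall N}
    (hg : g ∈ confGroup N) {c c' : ClosedUnitBall N} (hc : c ∈ bdSphere N) (hc' : c' ∈ bdSphere N)
    {r : ℝ} (hr0 : 0 < r) (hr1 : r < 2) (himg : g '' bdExt c r = bdDisc c' r) :
    1 - ‖(g⁻¹ (origin N) : Euc N)‖ ^ 2 < r ^ 2 ∧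
    ‖(g⁻¹ (origin N) : Euc N) - (c : Euc N)‖ ^ 2 =
      r ^ 2 - (1 - ‖(g⁻¹ (origin N) : Euc N)‖ ^ 2) := by
  have hap := one_sub_norm_sq_pos (inv_origin_mem_hypBall hg)
  obtain ⟨p, hp, hgp⟩ : c' ∈ g '' bdExt c r := by
    rw [himg]
    exact ⟨hc', by simpa using hr0⟩
  have hjp := confDeriv_of_mem_bdSphere g hp.1
  have hjp0 := confDeriv_pos hg p
  have hjx : ∀ x ∈ bdSphere N, confDeriv g x = _ := fun x hx => confDeriv_of_mem_bdSphere g hx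
  have hd0 : ∀ x ∈ bdSphere N, 0 < ‖(x : Euc N) - (g⁻¹ (origin N) : Euc N)‖ ^ 2 := by
    intro x hx
    have h1 := confDenom_inv_origin_pos hg x
    have hx1 : ‖(x : Euc N)‖ = 1 := hx
    rw [confDenom_eq, hx1] at h1
    linarith
  set a : Euc N := (g⁻¹ (origin N) : Euc N) with ha
  set l : ℝ := 1 - ‖a‖ ^ 2 with hl
  -- With `g p = c'`, the condition `|g x - c'|² < r²` becomes `m |x - p|² < r² |x - a|²`, which is
  -- affine in `x` on the sphere. Comparing it with the affine description of the exterior of the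
  -- disc determines `a`.
  set m : ℝ := l * confDeriv g p with hm
  have hm0 : 0 < m := mul_pos hap hjp0
  have hcn : ‖(c : Euc N)‖ = 1 := hc
  have hpn : ‖(p : Euc N)‖ = 1 := hp.1
  have hmp : m * ‖(p : Euc N) - a‖ ^ 2 = l ^ 2 := by
    rw [hm, hjp]
    rw [mul_assoc, div_mul_cancel₀ _ (hd0 p hp.1).ne']
    ring
  have hext : ∀ x ∈ bdSphere N, (x ∈ bdExt c r ↔ 0 < (2 - r ^ 2) - 2 * inner ℝ (x : Euc N) c) := by
    intro x hx
    have hx1 : ‖(x : Euc N)‖ = 1 := hx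
    have h1 := norm_sub_sq_real (x : Euc N) (c : Euc N)
    rw [hx1, hcn] at h1
    have h2 : x ∈ bdExt c r ↔ r < ‖(x : Euc N) - (c : Euc N)‖ := by
      rw [← dist_eq_norm]
      exact ⟨fun h => h.2, fun h => ⟨hx, h⟩⟩
    rw [h2, ← sq_lt_sq₀ hr0.le (norm_nonneg _), h1]
    constructor <;> intro h <;> linarith
  have key := affine_proportional hN (c := (c : Euc N)) (v := m • (p : Euc N) - r ^ 2 • a)
    (t := 2 - r ^ 2) (τ := 2 * m - r ^ 2 * (1 + ‖a‖ ^ 2)) hcn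
    ⟨by nlinarith, by nlinarith⟩ (by
      intro x hx
      obtain ⟨x, rfl⟩ : ∃ y : ClosedUnitBall N, (y : Euc N) = x := ⟨⟨x, by simpa using hx.le⟩, rfl⟩
      rw [← hext x hx]
      have h1 : x ∈ bdExt c r ↔ g x ∈ bdDisc c' r := by
        rw [← himg, g.injective.mem_set_image]
      have h2 : g x ∈ bdDisc c' r ↔ ‖(g x : Euc N) - (g p : Euc N)‖ ^ 2 < r ^ 2 := by
        rw [sq_lt_sq₀ (norm_nonneg _) hr0.le, hgp, ← dist_eq_norm]
        exact ⟨fun h => h.2, fun h => ⟨confGroup_mem_bdSphere hg hx, h⟩⟩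
      have h3 := hd0 x hx
      have e1 := norm_sub_sq_real (x : Euc N) a
      have e2 := norm_sub_sq_real (x : Euc N) (p : Euc N)
      rw [hx, hpn] at e2
      rw [hx] at e1
      rw [h1, h2, norm_map_sub_map_sq hg, hjx x hx,
        show l / ‖(x : Euc N) - a‖ ^ 2 * confDeriv g p * ‖(x : Euc N) - (p : Euc N)‖ ^ 2
          = m * ‖(x : Euc N) - (p : Euc N)‖ ^ 2 / ‖(x : Euc N) - a‖ ^ 2 by rw [hm]; ring,
        div_lt_iff₀ h3, e1, e2, inner_sub_right, inner_smul_right, inner_smul_right]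
      constructor <;> intro h <;> linarith)
  obtain ⟨k1, k2⟩ := key
  set κ : ℝ := inner ℝ (c : Euc N) (m • (p : Euc N) - r ^ 2 • a) with hκ
  have e3 := norm_sub_sq_real (p : Euc N) a
  rw [hpn] at e3
  have hnorm : m ^ 2 - 2 * (m * r ^ 2 * inner ℝ (p : Euc N) a) + r ^ 4 * ‖a‖ ^ 2 = κ ^ 2 := by
    have h1 := congrArg (fun y => ‖y‖ ^ 2) k1
    simp only [norm_smul, hcn, mul_one, Real.norm_eq_abs, sq_abs] at h1
    rw [norm_sub_sq_real, norm_smul, norm_smul, hpn, inner_smul_left, inner_smul_right] at h1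
    simp only [Real.norm_eq_abs, mul_one, sq_abs, mul_pow] at h1
    rw [← h1]
    simp
    ring
  have hκsq : κ ^ 2 = l ^ 2 := by
    -- This is `4 - t²` for `t = 2 - r²`; it arises from computing `τ² - 4 |v|²` in two ways.
    have hq : 0 < 4 * r ^ 2 - r ^ 4 := by
      have h1 : 0 < 4 - r ^ 2 := by nlinarith
      have h2 := mul_pos (pow_pos hr0 2) h1
      linarith
    refine mul_right_cancel₀ hq.ne' ?_
    have h1 : m * (1 ^ 2 - 2 * inner ℝ (p : Euc N) a + ‖a‖ ^ 2) = l ^ 2 := by rw [← e3, hmp]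
    have h2 : (2 * m - r ^ 2 * (1 + ‖a‖ ^ 2)) ^ 2 = ((2 - r ^ 2) * κ) ^ 2 := by rw [k2]
    have h3 : ‖a‖ ^ 2 = 1 - l := by rw [hl]; ring
    rw [h3] at h1 h2 hnorm
    linear_combination h2 - 4 * hnorm + 4 * r ^ 2 * h1
  -- The sign is read off at `x = p`, which lies in the exterior and makes the term `m |x - p|²`
  -- vanish.
  have hκneg : κ < 0 := by
    have h1 := (hext p hp.1).1 hp
    have h2 : (2 * m - r ^ 2 * (1 + ‖a‖ ^ 2)) - 2 * inner ℝ (p : Euc N) (m • (p : Euc N) - r ^ 2 • a)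
        = -(r ^ 2 * ‖(p : Euc N) - a‖ ^ 2) := by
      rw [inner_sub_right, inner_smul_right, inner_smul_right, real_inner_self_eq_norm_sq, hpn, e3]
      ring
    rw [k1, k2, inner_smul_right] at h2
    have h3 := mul_pos (pow_pos hr0 2) (hd0 p hp.1)
    have h4 : κ * ((2 - r ^ 2) - 2 * inner ℝ (p : Euc N) c) < 0 := by linarith
    exact neg_of_mul_neg_left h4 h1.le
  have hκl : κ = -l := by
    rcases sq_eq_sq_iff_eq_or_eq_neg.1 hκsq with h | h
    · linarith
    · exact h
  have hml : m = r ^ 2 - l := by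
    rw [hκl] at k2
    have : ‖a‖ ^ 2 = 1 - l := by rw [hl]; ring
    rw [this] at k2
    linarith
  refine ⟨by linarith, ?_⟩
  have k3 : m • (p : Euc N) = r ^ 2 • a - l • (c : Euc N) := by
    rw [hκl, sub_eq_iff_eq_add] at k1
    rw [k1, neg_smul]
    abel
  have h1 := congrArg (fun y => ‖y‖ ^ 2) k3
  simp only [norm_sub_sq_real, norm_smul, hpn, hcn, real_inner_smul_left, inner_smul_right,
    Real.norm_eq_abs, mul_one, sq_abs, mul_pow] at h1
  have h3 : ‖a‖ ^ 2 = 1 - l := by rw [hl]; ring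
  rw [h3, hml] at h1
  rw [norm_sub_sq_real, hcn, h3]
  have hrl : r ^ 2 * l ≠ 0 := by positivity
  refine mul_left_cancel₀ hrl ?_
  linear_combination -h1

theorem confDeriv_le_of_far (hN : 1 ≤ N) {g : ClosedUnitBall N ≃ₜ ClosedUnitBall N}
    (hg : g ∈ confGroup N) {c c' : ClosedUnitBall N} (hc : c ∈ bdSphere N) (hc' : c' ∈ bdSphere N)
    {r q : ℝ} (hr0 : 0 < r) (hr1 : r < 2) (hq : 2 ≤ q) (himg : g '' bdExt c r = bdDisc c' r)
    {x : ClosedUnitBall N} (hx : x ∈ bdSphere N) (hxc : q * r ≤ dist x c) :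
    confDeriv g x ≤ (2 / q) ^ 2 := by
  obtain ⟨h1, h2⟩ := preimage_origin_of_image_bdExt hN hg hc hc' hr0 hr1 himg
  have hap := one_sub_norm_sq_pos (inv_origin_mem_hypBall hg)
  rw [confDeriv_of_mem_bdSphere g hx]
  set a : Euc N := (g⁻¹ (origin N) : Euc N)
  have h3 : ‖a - (c : Euc N)‖ ≤ r := by
    rw [← sq_le_sq₀ (norm_nonneg _) hr0.le]
    linarith
  have h4 : dist x c ≤ ‖(x : Euc N) - a‖ + ‖a - (c : Euc N)‖ := by
    rw [Subtype.dist_eq, dist_eq_norm]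
    exact norm_sub_le_norm_sub_add_norm_sub _ _ _
  -- Since `q ≥ 2`, one has `q r - r ≥ q r / 2`.
  have h5 : q * r / 2 ≤ ‖(x : Euc N) - a‖ := by nlinarith
  have h6 : 0 < q * r / 2 := by positivity
  calc (1 - ‖a‖ ^ 2) / ‖(x : Euc N) - a‖ ^ 2 ≤ r ^ 2 / (q * r / 2) ^ 2 := by gcongr
    _ = (2 / q) ^ 2 := by field_simp

end SchottkyLetter

/-! ### Multiplicative weights summed over all words. -/

section ListSums

variable {α : Type*}

theorem ENNReal.tsum_fin_prod (W : α → ENNReal) (k : ℕ) :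
    ∑' f : Fin k → α, ∏ i, W (f i) = (∑' a, W a) ^ k := by
  induction k with
  | zero => simp [tsum_fintype]
  | succ k ih =>
    rw [← (Fin.consEquiv fun _ => α).tsum_eq, ENNReal.tsum_prod', pow_succ', ← ih,
      ← ENNReal.tsum_mul_right]
    refine tsum_congr fun a => ?_
    rw [← ENNReal.tsum_mul_left]
    refine tsum_congr fun f => ?_
    rw [Fin.prod_univ_succ]
    simp [Fin.consEquiv]

/-- Sorted by length, the words of length `k` contribute the `k`-th power of the total letter
weight. Working in `ENNReal` makes all rearrangements free. -/
theorem ENNReal.tsum_list_prod (W : α → ENNReal) :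
    ∑' l : List α, (l.map W).prod = (1 - ∑' a, W a)⁻¹ := by
  rw [← (List.equivSigmaTuple (α := α)).symm.tsum_eq, ENNReal.tsum_sigma',
    ← ENNReal.tsum_geometric]
  refine tsum_congr fun k => ?_
  rw [← ENNReal.tsum_fin_prod]
  refine tsum_congr fun f => ?_
  simp [List.equivSigmaTuple, List.map_ofFn, List.prod_ofFn]

theorem summable_list_prod {w : α → ℝ} (h0 : ∀ a, 0 ≤ w a)
    (h : ∑' a, ENNReal.ofReal (w a) < 1) : Summable fun l : List α => (l.map w).prod := by
  have h1 : ∑' l : List α, (l.map fun a => ENNReal.ofReal (w a)).prod ≠ ⊤ := by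
    rw [ENNReal.tsum_list_prod]
    exact ENNReal.inv_ne_top.2 (tsub_pos_of_lt h).ne'
  convert ENNReal.summable_toReal h1 with l
  induction l with
  | nil => simp
  | cons a l ih => simp [ENNReal.toReal_mul, h0 a, ih]

end ListSums

/-! ### Ping-pong and convergence of the horospherical series. -/

section SchottkyGroup

variable {N : ℕ} {φ : ℕ → ℝ}

/-- The generator `g_n` or its inverse, mapping the exterior of `C n ε` onto `C n (!ε)`. -/
def SchottkyData.letter (S : SchottkyData N φ) (x : ℕ × Bool) :
    ClosedUnitBall N ≃ₜ ClosedUnitBall N :=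
  bif x.2 then S.gen x.1 else (S.gen x.1)⁻¹

theorem SchottkyData.letter_mem (S : SchottkyData N φ) (x : ℕ × Bool) :
    S.letter x ∈ confGroup N := by
  obtain ⟨n, _ | _⟩ := x
  · exact inv_mem (S.gen_mem n)
  · exact S.gen_mem n

theorem SchottkyData.letter_image (S : SchottkyData N φ) (x : ℕ × Bool) :
    S.letter x '' bdExt (S.centre x.1 x.2) (S.radius x.1) =
      bdDisc (S.centre x.1 (!x.2)) (S.radius x.1) := by
  obtain ⟨n, _ | _⟩ := x
  · exact S.gen_inv_image n
  · exact S.gen_image n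

/-- The action of a reduced word on a point outside all enlarged discs. -/
theorem SchottkyData.word_estimate (hN : 1 ≤ N) {s : ℝ} (hs : 0 ≤ s) (hφ : ∀ n, 2 ≤ φ n)
    (S : SchottkyData N φ) {ζ : ClosedUnitBall N} (hζ : ζ ∈ bdSphere N)
    (hext : ∀ n ε, φ n * S.radius n ≤ dist ζ (S.centre n ε)) (L : List (ℕ × Bool))
    (hL : FreeGroup.IsReduced L) :
    (L.map S.letter).prod ∈ confGroup N ∧
    confDeriv (L.map S.letter).prod ζ ^ s ≤ (L.map fun x => (4 / φ x.1) ^ (2 * s)).prod ∧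
    ∀ x ∈ L.head?, (L.map S.letter).prod ζ ∈ bdDisc (S.centre x.1 (!x.2)) (S.radius x.1) := by
  induction L with
  | nil => exact ⟨one_mem _, by simp [confDeriv_one], by simp⟩
  | cons x L ih =>
    obtain ⟨h1, h2, h3⟩ := ih (hL.infix (List.suffix_cons x L).isInfix)
    rw [List.map_cons, List.prod_cons, List.map_cons, List.prod_cons]
    set h := (L.map S.letter).prod with hh
    have hr := S.radius_pos x.1
    have hq := hφ x.1
    have hsph : h ζ ∈ bdSphere N := confGroup_mem_bdSphere h1 hζ
    -- The next letter `y` has put the point into the disc `(y.1, !y.2)`. Reducedness makes this a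
    -- different disc from that of `x`, and enlarged discs are disjoint.
    have hfar : φ x.1 * S.radius x.1 ≤ dist (h ζ) (S.centre x.1 x.2) := by
      cases L with
      | nil => exact hext _ _
      | cons y L =>
        have hy := h3 y (by simp)
        have hne : (y.1, !y.2) ≠ (x.1, x.2) := by
          intro he
          have h4 := (FreeGroup.isReduced_cons_cons.1 hL).1
          simp only [Prod.mk.injEq] at he
          have h5 := h4 he.1.symm
          rw [h5] at he
          simp at he
        have hd := S.disjoint_enlarged _ _ _ _ hne
        have hy' : h ζ ∈ bdDisc (S.centre y.1 (!y.2)) (φ y.1 * S.radius y.1) := by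
          refine ⟨hsph, hy.2.trans_le ?_⟩
          nlinarith [hφ y.1, S.radius_pos y.1]
        by_contra hlt
        exact Set.disjoint_left.1 hd hy' ⟨hsph, not_le.1 hlt⟩
    refine ⟨mul_mem (S.letter_mem x) h1, ?_, ?_⟩
    · rw [confDeriv_mul (S.letter_mem x) h1,
        Real.mul_rpow (confDeriv_pos (S.letter_mem x) _).le (confDeriv_pos h1 _).le]
      have h5 := confDeriv_le_of_far hN (S.letter_mem x) (S.centre_mem x.1 x.2)
        (S.centre_mem x.1 (!x.2)) hr ((S.radius_lt_one x.1).trans one_lt_two) hq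
        (S.letter_image x) hsph hfar
      -- The bound with `2 / φ` is already available; `4 / φ` is only the weight in the hypothesis.
      have h6 : confDeriv (S.letter x) (h ζ) ^ s ≤ (4 / φ x.1) ^ (2 * s) := by
        have hpos := confDeriv_pos (S.letter_mem x) (h ζ)
        rw [Real.rpow_mul (by positivity), Real.rpow_two]
        refine Real.rpow_le_rpow hpos.le (h5.trans ?_) hs
        gcongr
        norm_num
      have := Real.rpow_nonneg (confDeriv_pos h1 ζ).le s
      exact mul_le_mul h6 h2 this (by positivity)
    · intro y hy
      obtain rfl : x = y := by simpa using hy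
      rw [← S.letter_image]
      refine ⟨h ζ, ⟨hsph, ?_⟩, rfl⟩
      nlinarith

theorem SchottkyData.poincareConverges (hN : 1 ≤ N) {s : ℝ} (hs : 0 < s) (hφ : ∀ n, 2 ≤ φ n)
    (hsummable : Summable fun n => (4 / φ n) ^ (2 * s))
    (hsum : ∑' n, (4 / φ n) ^ (2 * s) < 1 / 2)
    (S : SchottkyData N φ) {ζ : ClosedUnitBall N} (hζ : ζ ∈ bdSphere N)
    (hext : ∀ n ε, φ n * S.radius n ≤ dist ζ (S.centre n ε)) : PoincareConverges S.group ζ s := by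
  have hw0 : ∀ n, 0 ≤ (4 / φ n) ^ (2 * s) := fun n => by
    have := hφ n
    positivity
  -- Each index gives two letters, a generator and its inverse, which accounts for the `1 / 2` in
  -- the hypothesis.
  have hlt : ∑' x : ℕ × Bool, ENNReal.ofReal ((4 / φ x.1) ^ (2 * s)) < 1 := by
    rw [ENNReal.tsum_prod']
    simp only [tsum_fintype, Finset.sum_const, Finset.card_univ, Fintype.card_bool, nsmul_eq_mul]
    rw [ENNReal.tsum_mul_left, ← ENNReal.ofReal_tsum_of_nonneg hw0 hsummable]
    have h1 : ENNReal.ofReal (∑' n, (4 / φ n) ^ (2 * s)) < ENNReal.ofReal (1 / 2) :=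
      (ENNReal.ofReal_lt_ofReal_iff (by norm_num)).2 hsum
    calc ((2 : ℕ) : ENNReal) * ENNReal.ofReal (∑' n, (4 / φ n) ^ (2 * s))
        < ((2 : ℕ) : ENNReal) * ENNReal.ofReal (1 / 2) :=
          ENNReal.mul_lt_mul_right (by norm_num) (by norm_num) h1
      _ = 1 := by
          rw [← ENNReal.ofReal_natCast, ← ENNReal.ofReal_mul (by norm_num)]
          norm_num
  have hlist := summable_list_prod (fun x : ℕ × Bool => hw0 x.1) hlt
  have hsurj : ∀ g : S.group, ∃ x : FreeGroup ℕ, FreeGroup.lift S.gen x = g := by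
    intro g
    have h1 : (g : ClosedUnitBall N ≃ₜ ClosedUnitBall N) ∈ (FreeGroup.lift S.gen).range := by
      rw [FreeGroup.range_lift_eq_closure]
      exact g.2
    exact h1
  choose σ hσ using hsurj
  -- One reduced word is chosen per group element, so freeness of the group is not needed.
  have hinj : Function.Injective fun g : S.group => (σ g).toWord := by
    intro g g' h
    have h1 : σ g = σ g' := FreeGroup.toWord_injective h
    exact Subtype.ext (by rw [← hσ g, ← hσ g', h1])
  refine Summable.of_nonneg_of_le (fun g => ?_) (fun g => ?_) (hlist.comp_injective hinj)
  · exact Real.rpow_nonneg (confDeriv_pos (S.group_le g.2) ζ).le s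
  · have h1 : (g : ClosedUnitBall N ≃ₜ ClosedUnitBall N) =
        ((σ g).toWord.map S.letter).prod := by
      rw [← hσ g, ← FreeGroup.mk_toWord (x := σ g), FreeGroup.lift_mk, FreeGroup.mk_toWord]
      rfl
    have h2 := (S.word_estimate hN hs.le hφ hζ hext _
      (FreeGroup.isReduced_toWord (x := σ g))).2.1
    rw [← h1] at h2
    exact h2

end SchottkyGroup

/-! ### Non-tangential approach and domination along ending sequences. -/

section EndingSequences

variable {N : ℕ}

theorem sinh_sub_le {x y : ℝ} (hy : 0 ≤ y) :
    Real.sinh (x - y) ≤ Real.exp (-y) * Real.sinh x := by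
  rw [Real.sinh_eq, Real.sinh_eq, mul_div_assoc', mul_sub, ← Real.exp_add, ← Real.exp_add]
  have h1 : Real.exp (-y + -x) ≤ Real.exp (-(x - y)) := Real.exp_le_exp.2 (by linarith)
  have h2 : Real.exp (x - y) = Real.exp (-y + x) := by congr 1; ring
  rw [h2]
  linarith

theorem sinh_sq_lt_exp {t : ℝ} (ht : 0 ≤ t) : Real.sinh (t / 2) ^ 2 + 1 ≤ Real.exp t := by
  have h : Real.cosh (t / 2) ≤ Real.exp (t / 2) := by
    rw [Real.cosh_eq]
    have := Real.exp_le_exp.2 (show -(t / 2) ≤ t / 2 by linarith)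
    linarith
  have h2 := pow_le_pow_left₀ (Real.cosh_pos _).le h 2
  have e : ((2 : ℕ) : ℝ) * (t / 2) = t := by
    push_cast
    ring
  rwa [← Real.exp_nat_mul, Real.cosh_sq, e] at h2

/-- The points of a geodesic ray towards `ζ` approach `ζ` non-tangentially. -/
theorem IsGeodesicRay.nontangential {γ : ℝ → ClosedUnitBall N} {ζ : ClosedUnitBall N}
    (hγ : IsGeodesicRay γ ζ) : ∃ K : ℝ, 0 < K ∧ ∀ t, 0 ≤ t →
      ‖(ζ : Euc N) - (γ t : Euc N)‖ ^ 2 ≤ K * (1 - ‖(γ t : Euc N)‖ ^ 2) ^ 2 := by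
  obtain ⟨hball, hdist, -, hlim⟩ := hγ
  have p0 := one_sub_norm_sq_pos (hball 0 le_rfl)
  have q0 : 0 < (1 - ‖(γ 0 : Euc N)‖) ^ 2 := by
    have : ‖(γ 0 : Euc N)‖ < 1 := hball 0 le_rfl
    have : 0 < 1 - ‖(γ 0 : Euc N)‖ := by linarith
    positivity
  refine ⟨4 / ((1 - ‖(γ 0 : Euc N)‖ ^ 2) * (1 - ‖(γ 0 : Euc N)‖) ^ 2), by positivity, ?_⟩
  intro t ht
  have pt := one_sub_norm_sq_pos (hball t ht)
  -- Compare the distances from `γ u` to `γ t` and to `γ 0`: the factor `1 - |γ u|²` cancels, and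
  -- then `u → ∞`.
  have h1 : ‖(ζ : Euc N) - (γ t : Euc N)‖ ^ 2 ≤
      4 / (1 - ‖(γ 0 : Euc N)‖ ^ 2) * Real.exp (-t) * (1 - ‖(γ t : Euc N)‖ ^ 2) := by
    have hl : Tendsto (fun u => ‖(γ u : Euc N) - (γ t : Euc N)‖ ^ 2) atTop
        (𝓝 (‖(ζ : Euc N) - (γ t : Euc N)‖ ^ 2)) :=
      (((continuous_subtype_val.tendsto ζ).comp hlim).sub_const _).norm.pow 2
    refine le_of_tendsto hl ?_
    filter_upwards [eventually_ge_atTop t] with u hu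
    have hu0 : 0 ≤ u := ht.trans hu
    have pu := one_sub_norm_sq_pos (hball u hu0)
    have e1 := sinh_half_hypDist_sq (hball u hu0) (hball t ht)
    have e2 := sinh_half_hypDist_sq (hball u hu0) (hball 0 le_rfl)
    rw [hdist u t hu0 ht, abs_of_nonneg (by linarith)] at e1
    rw [hdist u 0 hu0 le_rfl, sub_zero, abs_of_nonneg hu0] at e2
    have h2 : Real.sinh ((u - t) / 2) ^ 2 ≤ Real.exp (-t) * Real.sinh (u / 2) ^ 2 := by
      have h3 := sinh_sub_le (x := u / 2) (y := t / 2) (by linarith)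
      rw [← sub_div] at h3
      have h4 := pow_le_pow_left₀ (Real.sinh_nonneg_iff.2 (by linarith)) h3 2
      have e : ((2 : ℕ) : ℝ) * (-(t / 2)) = -t := by
        push_cast
        ring
      rwa [mul_pow, ← Real.exp_nat_mul, e] at h4
    rw [e1, e2, div_le_iff₀ (by positivity)] at h2
    refine h2.trans ?_
    have h5 : ‖(γ u : Euc N) - (γ 0 : Euc N)‖ ^ 2 ≤ 4 := by
      have h6 := norm_sub_le (γ u : Euc N) (γ 0 : Euc N)
      have h7 := norm_coe_le_one (γ u)
      have h8 := norm_coe_le_one (γ 0)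
      nlinarith [norm_nonneg ((γ u : Euc N) - (γ 0 : Euc N))]
    calc Real.exp (-t) * (‖(γ u : Euc N) - (γ 0 : Euc N)‖ ^ 2 /
          ((1 - ‖(γ u : Euc N)‖ ^ 2) * (1 - ‖(γ 0 : Euc N)‖ ^ 2))) *
          ((1 - ‖(γ u : Euc N)‖ ^ 2) * (1 - ‖(γ t : Euc N)‖ ^ 2))
        = ‖(γ u : Euc N) - (γ 0 : Euc N)‖ ^ 2 / (1 - ‖(γ 0 : Euc N)‖ ^ 2) * Real.exp (-t) *
          (1 - ‖(γ t : Euc N)‖ ^ 2) := by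
          field_simp
      _ ≤ _ := by gcongr
  -- Uses `cosh² (t / 2) ≤ exp t`, where `cosh²` is the quotient of `confDenom` by the two boundary
  -- factors. It turns the remaining `exp (-t)` into a second factor `1 - |γ t|²`.
  have h2 : Real.exp (-t) * (1 - ‖(γ 0 : Euc N)‖) ^ 2 ≤ 1 - ‖(γ t : Euc N)‖ ^ 2 := by
    have e1 := sinh_half_hypDist_sq (hball t ht) (hball 0 le_rfl)
    rw [hdist t 0 ht le_rfl, sub_zero, abs_of_nonneg ht] at e1
    have h3 := sinh_sq_lt_exp ht
    rw [e1, div_add_one (by positivity), ← confDenom_eq, div_le_iff₀ (by positivity)] at h3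
    have h4 := sq_one_sub_mul_le_confDenom (γ t : Euc N) (γ 0 : Euc N)
    have h5 : (1 - ‖(γ 0 : Euc N)‖) ^ 2 ≤ (1 - ‖(γ t : Euc N)‖ * ‖(γ 0 : Euc N)‖) ^ 2 := by
      have h6 := norm_coe_le_one (γ t)
      have h7 := norm_coe_le_one (γ 0)
      have h8 := norm_nonneg (γ 0 : Euc N)
      refine pow_le_pow_left₀ (by linarith) ?_ 2
      nlinarith
    have h6 : (1 - ‖(γ t : Euc N)‖ ^ 2) * (1 - ‖(γ 0 : Euc N)‖ ^ 2) ≤ 1 - ‖(γ t : Euc N)‖ ^ 2 := by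
      nlinarith [sq_nonneg ‖(γ 0 : Euc N)‖]
    calc Real.exp (-t) * (1 - ‖(γ 0 : Euc N)‖) ^ 2
        ≤ Real.exp (-t) * (Real.exp t * (1 - ‖(γ t : Euc N)‖ ^ 2)) := by
          have := Real.exp_pos t
          gcongr
          nlinarith
      _ = 1 - ‖(γ t : Euc N)‖ ^ 2 := by
          rw [← mul_assoc, ← Real.exp_add, neg_add_cancel, Real.exp_zero, one_mul]
  refine h1.trans ?_
  have h3 : Real.exp (-t) ≤ (1 - ‖(γ t : Euc N)‖ ^ 2) / (1 - ‖(γ 0 : Euc N)‖) ^ 2 :=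
    (le_div_iff₀ q0).2 h2
  calc 4 / (1 - ‖(γ 0 : Euc N)‖ ^ 2) * Real.exp (-t) * (1 - ‖(γ t : Euc N)‖ ^ 2)
      ≤ 4 / (1 - ‖(γ 0 : Euc N)‖ ^ 2) * ((1 - ‖(γ t : Euc N)‖ ^ 2) / (1 - ‖(γ 0 : Euc N)‖) ^ 2) *
        (1 - ‖(γ t : Euc N)‖ ^ 2) := by gcongr
    _ = _ := by field_simp

/-- At bounded hyperbolic distance, `1 - |y|²` is at most a constant times `1 - |z|²`, and `|z - y|`
is of at most that order as well; the triangle inequality does the rest. -/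
theorem nontangential_of_hypDist_le {K C : ℝ} (hK : 0 < K) :
    ∃ K' : ℝ, 0 < K' ∧ ∀ ζ y z : ClosedUnitBall N, y ∈ hypBall N → z ∈ hypBall N →
      hypDist z y ≤ C → ‖(ζ : Euc N) - (y : Euc N)‖ ^ 2 ≤ K * (1 - ‖(y : Euc N)‖ ^ 2) ^ 2 →
      ‖(ζ : Euc N) - (z : Euc N)‖ ^ 2 ≤ K' * (1 - ‖(z : Euc N)‖ ^ 2) ^ 2 := by
  set A : ℝ := Real.sinh (C / 2) ^ 2 with hA
  have hA0 : 0 ≤ A := sq_nonneg _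
  refine ⟨2 * K * (4 * (A + 1)) ^ 2 + 2 * (A * (4 * (A + 1))), by positivity, ?_⟩
  intro ζ y z hy hz hd hn
  have py := one_sub_norm_sq_pos hy
  have pz := one_sub_norm_sq_pos hz
  have h0 := hypDist_nonneg z y
  have h1 : Real.sinh (hypDist z y / 2) ^ 2 ≤ A :=
    pow_le_pow_left₀ (Real.sinh_nonneg_iff.2 (by linarith)) (Real.sinh_le_sinh.2 (by linarith)) 2
  rw [sinh_half_hypDist_sq hz hy, div_le_iff₀ (by positivity)] at h1
  have h2 : (1 - ‖(y : Euc N)‖ ^ 2) ≤ 4 * (A + 1) * (1 - ‖(z : Euc N)‖ ^ 2) := by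
    have h3 := sq_one_sub_mul_le_confDenom (z : Euc N) (y : Euc N)
    rw [confDenom_eq] at h3
    have hy1 : ‖(y : Euc N)‖ < 1 := hy
    have h4 : (1 - ‖(y : Euc N)‖) ^ 2 ≤ (1 - ‖(z : Euc N)‖ * ‖(y : Euc N)‖) ^ 2 := by
      refine pow_le_pow_left₀ (by linarith) ?_ 2
      nlinarith [norm_coe_le_one z, norm_nonneg (y : Euc N)]
    have h5 : (1 - ‖(y : Euc N)‖ ^ 2) ^ 2 ≤ 4 * (1 - ‖(y : Euc N)‖) ^ 2 := by
      have : (1 - ‖(y : Euc N)‖ ^ 2) ^ 2 =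
          (1 + ‖(y : Euc N)‖) ^ 2 * (1 - ‖(y : Euc N)‖) ^ 2 := by ring
      rw [this]
      gcongr
      nlinarith [norm_nonneg (y : Euc N)]
    refine le_of_mul_le_mul_right ?_ py
    nlinarith
  have h3 : ‖(ζ : Euc N) - (z : Euc N)‖ ^ 2 ≤
      2 * ‖(ζ : Euc N) - (y : Euc N)‖ ^ 2 + 2 * ‖(z : Euc N) - (y : Euc N)‖ ^ 2 := by
    have h4 := norm_sub_le_norm_sub_add_norm_sub (ζ : Euc N) (y : Euc N) (z : Euc N)
    rw [norm_sub_rev (y : Euc N) (z : Euc N)] at h4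
    have h5 := pow_le_pow_left₀ (norm_nonneg _) h4 2
    nlinarith [sq_nonneg (‖(ζ : Euc N) - (y : Euc N)‖ - ‖(z : Euc N) - (y : Euc N)‖)]
  have h4 : (1 - ‖(y : Euc N)‖ ^ 2) ^ 2 ≤ (4 * (A + 1)) ^ 2 * (1 - ‖(z : Euc N)‖ ^ 2) ^ 2 := by
    rw [← mul_pow]
    exact pow_le_pow_left₀ py.le h2 2
  have h5 : A * ((1 - ‖(z : Euc N)‖ ^ 2) * (1 - ‖(y : Euc N)‖ ^ 2)) ≤
      A * (4 * (A + 1)) * (1 - ‖(z : Euc N)‖ ^ 2) ^ 2 := by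
    have h6 := mul_le_mul_of_nonneg_left h2 (mul_nonneg hA0 pz.le)
    nlinarith
  have h6 := mul_le_mul_of_nonneg_left h4 hK.le
  nlinarith

theorem IsEndingSequence.nontangential {G : Subgroup (ClosedUnitBall N ≃ₜ ClosedUnitBall N)}
    {w ζ : ClosedUnitBall N} {z : ℕ → ClosedUnitBall N} (hz : IsEndingSequence G w ζ z) :
    ∃ K : ℝ, 0 < K ∧ ∀ n,
      ‖(ζ : Euc N) - (z n : Euc N)‖ ^ 2 ≤ K * (1 - ‖(z n : Euc N)‖ ^ 2) ^ 2 := by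
  obtain ⟨hmem, ⟨γ, hγ, -, C, hC⟩, -⟩ := hz
  obtain ⟨K, hK, h⟩ := hγ.nontangential
  obtain ⟨K', hK', h'⟩ := nontangential_of_hypDist_le (N := N) (C := C) hK
  refine ⟨K', hK', fun n => ?_⟩
  obtain ⟨t, ht, htC⟩ := hC n
  exact h' ζ (γ t) (z n) (hγ.1 t ht) (hmem n).1 htC (h t ht)

/-- In a Dirichlet domain centred at `w` the conformal derivatives are bounded away from `w`. -/
theorem confDeriv_mul_le_of_mem_dirichletDomain
    {G : Subgroup (ClosedUnitBall N ≃ₜ ClosedUnitBall N)} (hG : G ≤ confGroup N)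
    {w z : ClosedUnitBall N} (hw : w ∈ hypBall N) (hz : z ∈ dirichletDomain G w)
    {g : ClosedUnitBall N ≃ₜ ClosedUnitBall N} (hg : g ∈ G) :
    confDeriv g z * ‖(z : Euc N) - (w : Euc N)‖ ^ 2 ≤ 4 := by
  have four : ∀ x y : ClosedUnitBall N, ‖(x : Euc N) - (y : Euc N)‖ ^ 2 ≤ 4 := by
    intro x y
    have h6 := norm_sub_le (x : Euc N) (y : Euc N)
    have h7 := norm_coe_le_one x
    have h8 := norm_coe_le_one y
    nlinarith [norm_nonneg ((x : Euc N) - (y : Euc N))]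
  by_cases h1 : g = 1
  · rw [h1, confDeriv_one, one_mul]
    exact four z w
  have hgc := hG hg
  -- Applied to `g⁻¹`, the Dirichlet condition reads `d (z, w) ≤ d (g z, w)`; rewriting `1 - |g z|²`
  -- brings out the factor `confDeriv g z`.
  have hd := (hz.2 g⁻¹ (inv_mem hg) (inv_ne_one.2 h1)).le
  have hgw : g⁻¹ w ∈ hypBall N := (confGroup_mem_hypBall_iff (inv_mem hgc) w).2 hw
  have e : g (g⁻¹ w) = w := g.apply_symm_apply w
  rw [← hgc.2.1 z hz.1 _ hgw, e] at hd
  have hgz := (confGroup_mem_hypBall_iff hgc z).2 hz.1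
  have h2 := sinh_half_hypDist_sq_le hd
  have pz := one_sub_norm_sq_pos hz.1
  have pw := one_sub_norm_sq_pos hw
  have pj := confDeriv_pos hgc z
  rw [sinh_half_hypDist_sq hz.1 hw, sinh_half_hypDist_sq hgz hw, one_sub_norm_sq_map hgc hz.1,
    div_le_div_iff₀ (by positivity) (by positivity)] at h2
  have h3 : confDeriv g z * ‖(z : Euc N) - (w : Euc N)‖ ^ 2 ≤
      ‖(g z : Euc N) - (w : Euc N)‖ ^ 2 := by
    have p : 0 < (1 - ‖(z : Euc N)‖ ^ 2) * (1 - ‖(w : Euc N)‖ ^ 2) := by positivity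
    refine le_of_mul_le_mul_right ?_ p
    linarith
  exact h3.trans (four _ _)

/-- Hypothesis `hB` says `j (g, z) ≤ B` for `a = g⁻¹ (0)`, and the conclusion compares the
denominators of `j` at `ζ` and `z`. The bound holds since `1 - |z|² ≤ (1 - |a|²) + 2 |z - a|`, so `1
- |z|²` is of order at most the square root of `confDenom z a`. -/
theorem norm_sub_sq_le_mul_confDenom {ζ z a : Euc N} {K B : ℝ} (hz : ‖z‖ ≤ 1)
    (ha : ‖a‖ ≤ 1) (hK : 0 ≤ K) (hζ : ‖ζ - z‖ ^ 2 ≤ K * (1 - ‖z‖ ^ 2) ^ 2)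
    (hB : 1 - ‖a‖ ^ 2 ≤ B * confDenom z a) :
    ‖ζ - a‖ ^ 2 ≤ (2 * K * (8 * B ^ 2 + 8) + 2) * confDenom z a := by
  have hD4 := confDenom_le_four hz ha
  have hz2 : 0 ≤ 1 - ‖z‖ ^ 2 := by nlinarith [norm_nonneg z]
  have ha2 : 0 ≤ 1 - ‖a‖ ^ 2 := by nlinarith [norm_nonneg a]
  have hDn : ‖z - a‖ ^ 2 ≤ confDenom z a := by
    rw [confDenom_eq]
    nlinarith [mul_nonneg hz2 ha2]
  set D := confDenom z a
  have hD0 : 0 ≤ D := (sq_nonneg _).trans hDn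
  have h1 : 1 - ‖z‖ ^ 2 ≤ B * D + 2 * ‖z - a‖ := by
    have h2 : ‖a‖ - ‖z‖ ≤ ‖z - a‖ := by
      rw [norm_sub_rev]
      exact norm_sub_norm_le a z
    have h3 : ‖a‖ ^ 2 - ‖z‖ ^ 2 ≤ 2 * ‖z - a‖ := by
      nlinarith [norm_nonneg a, norm_nonneg z, norm_nonneg (z - a)]
    linarith
  have h2 : (1 - ‖z‖ ^ 2) ^ 2 ≤ (8 * B ^ 2 + 8) * D := by
    have h3 := pow_le_pow_left₀ hz2 h1 2
    have h4 : (B * D + 2 * ‖z - a‖) ^ 2 ≤ 2 * (B * D) ^ 2 + 8 * ‖z - a‖ ^ 2 := by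
      nlinarith [sq_nonneg (B * D - 2 * ‖z - a‖)]
    have h5 : (B * D) ^ 2 ≤ 4 * B ^ 2 * D := by
      have := mul_le_mul_of_nonneg_left hD4 (mul_nonneg (sq_nonneg B) hD0)
      linarith
    linarith
  have h3 : ‖ζ - a‖ ^ 2 ≤ 2 * ‖ζ - z‖ ^ 2 + 2 * ‖z - a‖ ^ 2 := by
    have h5 := pow_le_pow_left₀ (norm_nonneg _) (norm_sub_le_norm_sub_add_norm_sub ζ z a) 2
    nlinarith [sq_nonneg (‖ζ - z‖ - ‖z - a‖)]
  have h4 := mul_le_mul_of_nonneg_left h2 hK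
  linarith

/-- Along an ending sequence all conformal derivatives are dominated by those at the limit. -/
theorem IsEndingSequence.exists_confDeriv_le
    {G : Subgroup (ClosedUnitBall N ≃ₜ ClosedUnitBall N)} (hG : G ≤ confGroup N)
    {w ζ : ClosedUnitBall N} {z : ℕ → ClosedUnitBall N} (hw : w ∈ hypBall N)
    (hζ : ζ ∈ bdSphere N) (hz : IsEndingSequence G w ζ z) :
    ∃ K : ℝ, 0 < K ∧ ∀ᶠ n in atTop, ∀ g ∈ G, confDeriv g (z n) ≤ K * confDeriv g ζ := by
  obtain ⟨K, hK, hnt⟩ := hz.nontangential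
  have hζ1 : ‖(ζ : Euc N)‖ = 1 := hζ
  have hw1 : ‖(w : Euc N)‖ < 1 := hw
  set b : ℝ := 1 - ‖(w : Euc N)‖
  have hb : 0 < b := by simp only [b]; linarith
  -- Since `|ζ - w| ≥ b`, eventually `|z n - w| > b / 2`, and the Dirichlet bound gives `j (g, z n)
  -- ≤ B`.
  set B : ℝ := 4 / (b / 2) ^ 2 with hB
  refine ⟨2 * K * (8 * B ^ 2 + 8) + 2, by positivity, ?_⟩
  have hlim : Tendsto (fun n => ‖(z n : Euc N) - (w : Euc N)‖) atTop
      (𝓝 ‖(ζ : Euc N) - (w : Euc N)‖) :=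
    (((continuous_subtype_val.tendsto ζ).comp hz.2.2).sub_const _).norm
  have hbz : b / 2 < ‖(ζ : Euc N) - (w : Euc N)‖ := by
    have := norm_sub_norm_le (ζ : Euc N) (w : Euc N)
    rw [hζ1] at this
    simp only [b] at hb ⊢
    linarith
  filter_upwards [hlim.eventually (lt_mem_nhds hbz)] with n hn g hg
  have hgc := hG hg
  have ha := inv_origin_mem_hypBall hgc
  have h1 := confDeriv_mul_le_of_mem_dirichletDomain hG hw (hz.1 n) hg
  have hj := confDeriv_pos hgc (z n)
  have h2 : confDeriv g (z n) ≤ B := by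
    rw [hB, le_div_iff₀ (by positivity)]
    refine le_trans ?_ h1
    gcongr
  have hD := confDenom_inv_origin_pos hgc (z n)
  have hDζ := confDenom_inv_origin_pos hgc ζ
  rw [confDeriv_eq, div_le_iff₀ hD] at h2
  have h3 := norm_sub_sq_le_mul_confDenom (norm_coe_le_one (z n)) (norm_coe_le_one _) hK.le
    (hnt n) h2
  have h4 : confDenom (ζ : Euc N) (g⁻¹ (origin N) : Euc N) =
      ‖(ζ : Euc N) - (g⁻¹ (origin N) : Euc N)‖ ^ 2 := by
    rw [confDenom_eq, hζ1]
    ring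
  rw [← h4] at h3
  have pa := one_sub_norm_sq_pos ha
  rw [confDeriv_eq, confDeriv_eq, mul_div_assoc', div_le_div_iff₀ hD hDζ]
  nlinarith

/-- Transfers convergence from `ζ` to each interior point; the constant depends on `z` but not on
`g`. -/
theorem confDeriv_le_of_mem_hypBall {g : ClosedUnitBall N ≃ₜ ClosedUnitBall N}
    (hg : g ∈ confGroup N) {z : ClosedUnitBall N} (hz : z ∈ hypBall N) (ζ : ClosedUnitBall N) :
    confDeriv g z ≤ 4 / (1 - ‖(z : Euc N)‖) ^ 2 * confDeriv g ζ := by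
  have ha := inv_origin_mem_hypBall hg
  have hz1 : ‖(z : Euc N)‖ < 1 := hz
  have hz0 : 0 < 1 - ‖(z : Euc N)‖ := by linarith
  have pa := one_sub_norm_sq_pos ha
  have hD := confDenom_inv_origin_pos hg z
  have hDζ := confDenom_inv_origin_pos hg ζ
  have h4 := confDenom_le_four (norm_coe_le_one ζ) (norm_coe_le_one (g⁻¹ (origin N)))
  have h5 : (1 - ‖(z : Euc N)‖) ^ 2 ≤ confDenom (z : Euc N) (g⁻¹ (origin N) : Euc N) := by
    refine le_trans ?_ (sq_one_sub_mul_le_confDenom _ _)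
    refine pow_le_pow_left₀ hz0.le ?_ 2
    have := norm_coe_le_one (g⁻¹ (origin N))
    nlinarith [norm_nonneg (z : Euc N)]
  rw [confDeriv_eq, confDeriv_eq, div_mul_div_comm, div_le_div_iff₀ hD (by positivity)]
  have h6 := mul_le_mul h4 le_rfl (sq_nonneg (1 - ‖(z : Euc N)‖)) (by norm_num)
  have h7 : (1 - ‖(z : Euc N)‖) ^ 2 * confDenom (ζ : Euc N) (g⁻¹ (origin N) : Euc N) ≤
      4 * confDenom (z : Euc N) (g⁻¹ (origin N) : Euc N) := by nlinarith
  nlinarith [mul_le_mul_of_nonneg_left h7 pa.le]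

end EndingSequences

/-! ### Orbit measures: weak limits, conformality, atoms. -/

section OrbitMeasure

open MeasureTheory

variable {N : ℕ} {G : Subgroup (ClosedUnitBall N ≃ₜ ClosedUnitBall N)} {s : ℝ}
  {z ζ : ClosedUnitBall N}

/-- The orbit measure before normalisation. -/
noncomputable def orbitSum (G : Subgroup (ClosedUnitBall N ≃ₜ ClosedUnitBall N)) (s : ℝ)
    (z : ClosedUnitBall N) : Measure (ClosedUnitBall N) :=
  Measure.sum fun g : G =>
    ENNReal.ofReal (confDeriv (g : ClosedUnitBall N ≃ₜ ClosedUnitBall N) z ^ s) •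
      Measure.dirac ((g : ClosedUnitBall N ≃ₜ ClosedUnitBall N) z)

theorem orbitSum_apply {A : Set (ClosedUnitBall N)} (hA : MeasurableSet A) :
    orbitSum G s z A = ∑' g : G,
      ENNReal.ofReal (confDeriv (g : ClosedUnitBall N ≃ₜ ClosedUnitBall N) z ^ s) *
        A.indicator 1 ((g : ClosedUnitBall N ≃ₜ ClosedUnitBall N) z) := by
  simp only [orbitSum, Measure.sum_apply _ hA, Measure.smul_apply, smul_eq_mul,
    Measure.dirac_apply' _ hA]

theorem lintegral_orbitSum {F : ClosedUnitBall N → ENNReal} :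
    ∫⁻ x, F x ∂(orbitSum G s z) = ∑' g : G,
      ENNReal.ofReal (confDeriv (g : ClosedUnitBall N ≃ₜ ClosedUnitBall N) z ^ s) *
        F ((g : ClosedUnitBall N ≃ₜ ClosedUnitBall N) z) := by
  simp only [orbitSum, lintegral_sum_measure, lintegral_smul_measure, lintegral_dirac, smul_eq_mul]

theorem orbitMeasure_eq (G : Subgroup (ClosedUnitBall N ≃ₜ ClosedUnitBall N)) (s : ℝ)
    (z : ClosedUnitBall N) : orbitMeasure G s z = (orbitSum G s z Set.univ)⁻¹ • orbitSum G s z := by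
  rw [orbitSum_apply MeasurableSet.univ]
  simp only [Set.indicator_univ, Pi.one_apply, mul_one]
  rfl

theorem orbitSum_univ (hG : G ≤ confGroup N) (h : PoincareConverges G z s) :
    orbitSum G s z Set.univ = ENNReal.ofReal
      (∑' g : G, confDeriv (g : ClosedUnitBall N ≃ₜ ClosedUnitBall N) z ^ s) := by
  rw [orbitSum_apply MeasurableSet.univ, ENNReal.ofReal_tsum_of_nonneg
    (fun g => Real.rpow_nonneg (confDeriv_pos (hG g.2) z).le s) h]
  simp

theorem tsum_confDeriv_pos (hG : G ≤ confGroup N) (h : PoincareConverges G z s) :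
    0 < ∑' g : G, confDeriv (g : ClosedUnitBall N ≃ₜ ClosedUnitBall N) z ^ s :=
  h.tsum_pos (fun g => Real.rpow_nonneg (confDeriv_pos (hG g.2) z).le s) 1
    (Real.rpow_pos_of_pos (confDeriv_pos (one_mem _) z) s)

theorem orbitSum_univ_ne_top (hG : G ≤ confGroup N) (h : PoincareConverges G z s) :
    orbitSum G s z Set.univ ≠ ⊤ := by
  rw [orbitSum_univ hG h]
  exact ENNReal.ofReal_ne_top

theorem orbitSum_univ_ne_zero (hG : G ≤ confGroup N) (h : PoincareConverges G z s) :
    orbitSum G s z Set.univ ≠ 0 := by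
  rw [orbitSum_univ hG h]
  exact (ENNReal.ofReal_pos.2 (tsum_confDeriv_pos hG h)).ne'

theorem isProbabilityMeasure_orbitMeasure (hG : G ≤ confGroup N) (h : PoincareConverges G z s) :
    IsProbabilityMeasure (orbitMeasure G s z) := by
  constructor
  rw [orbitMeasure_eq, Measure.smul_apply, smul_eq_mul]
  exact ENNReal.inv_mul_cancel (orbitSum_univ_ne_zero hG h) (orbitSum_univ_ne_top hG h)

theorem integral_orbitMeasure (hG : G ≤ confGroup N) (h : PoincareConverges G z s)
    (f : C(ClosedUnitBall N, ℝ)) :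
    ∫ x, f x ∂(orbitMeasure G s z) =
      (∑' g : G, confDeriv (g : ClosedUnitBall N ≃ₜ ClosedUnitBall N) z ^ s)⁻¹ *
      ∑' g : G, confDeriv (g : ClosedUnitBall N ≃ₜ ClosedUnitBall N) z ^ s *
        f ((g : ClosedUnitBall N ≃ₜ ClosedUnitBall N) z) := by
  have hfin : IsFiniteMeasure (orbitSum G s z) := ⟨(orbitSum_univ_ne_top hG h).lt_top⟩
  have hint : Integrable f (orbitSum G s z) :=
    f.continuous.integrable_of_hasCompactSupport (HasCompactSupport.of_compactSpace f)
  rw [orbitMeasure_eq, integral_smul_measure, orbitSum_univ hG h, ENNReal.toReal_inv,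
    ENNReal.toReal_ofReal (tsum_confDeriv_pos hG h).le, smul_eq_mul]
  congr 1
  rw [orbitSum] at hint ⊢
  rw [integral_sum_measure hint]
  refine tsum_congr fun g => ?_
  rw [integral_smul_measure, integral_dirac,
    ENNReal.toReal_ofReal (Real.rpow_nonneg (confDeriv_pos (hG g.2) z).le s), smul_eq_mul]

/-- Under a domination of the conformal derivatives the orbit measures converge weakly. -/
theorem tendsto_integral_orbitMeasure (hG : G ≤ confGroup N) (hs : 0 ≤ s)
    (hζ : PoincareConverges G ζ s) {z : ℕ → ClosedUnitBall N}
    (hz : ∀ n, PoincareConverges G (z n) s) (hlim : Tendsto z atTop (𝓝 ζ)) {K : ℝ} (hK : 0 ≤ K)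
    (hdom : ∀ᶠ n in atTop, ∀ g ∈ G, confDeriv g (z n) ≤ K * confDeriv g ζ)
    (f : C(ClosedUnitBall N, ℝ)) :
    Tendsto (fun n => ∫ x, f x ∂(orbitMeasure G s (z n))) atTop
      (𝓝 (∫ x, f x ∂(orbitMeasure G s ζ))) := by
  simp only [integral_orbitMeasure hG (hz _), integral_orbitMeasure hG hζ]
  have hterm : ∀ (g : G) (f : C(ClosedUnitBall N, ℝ)),
      Tendsto (fun n => confDeriv (g : ClosedUnitBall N ≃ₜ ClosedUnitBall N) (z n) ^ s *
        f ((g : ClosedUnitBall N ≃ₜ ClosedUnitBall N) (z n))) atTop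
        (𝓝 (confDeriv (g : ClosedUnitBall N ≃ₜ ClosedUnitBall N) ζ ^ s *
          f ((g : ClosedUnitBall N ≃ₜ ClosedUnitBall N) ζ))) := by
    intro g f
    have h1 := ((continuous_confDeriv (hG g.2)).tendsto ζ).comp hlim
    refine (h1.rpow_const (Or.inr hs)).mul ?_
    exact (((f.continuous.comp (g : ClosedUnitBall N ≃ₜ ClosedUnitBall N).continuous).tendsto
      ζ).comp hlim)
  have hsum : ∀ f : C(ClosedUnitBall N, ℝ),
      Tendsto (fun n => ∑' g : G, confDeriv (g : ClosedUnitBall N ≃ₜ ClosedUnitBall N) (z n) ^ s *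
        f ((g : ClosedUnitBall N ≃ₜ ClosedUnitBall N) (z n))) atTop
        (𝓝 (∑' g : G, confDeriv (g : ClosedUnitBall N ≃ₜ ClosedUnitBall N) ζ ^ s *
          f ((g : ClosedUnitBall N ≃ₜ ClosedUnitBall N) ζ))) := by
    intro f
    refine tendsto_tsum_of_dominated_convergence
      (bound := fun g : G =>
        K ^ s * confDeriv (g : ClosedUnitBall N ≃ₜ ClosedUnitBall N) ζ ^ s * ‖f‖)
      ((Summable.mul_left _ hζ).mul_right _) (fun g => hterm g f) ?_
    filter_upwards [hdom] with n hn g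
    have p1 := confDeriv_pos (hG g.2) (z n)
    have p2 := confDeriv_pos (hG g.2) ζ
    rw [norm_mul, Real.norm_of_nonneg (Real.rpow_nonneg p1.le s), ← Real.mul_rpow hK p2.le]
    exact mul_le_mul (Real.rpow_le_rpow p1.le (hn g g.2) hs) (f.norm_coe_le_norm _)
      (norm_nonneg _) (Real.rpow_nonneg (mul_nonneg hK p2.le) s)
  -- The constant function gives convergence of the normalising totals.
  have h1 := hsum (ContinuousMap.const _ 1)
  simp only [ContinuousMap.const_apply, mul_one] at h1
  exact (h1.inv₀ (tsum_confDeriv_pos hG hζ).ne').mul (hsum f)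

theorem poincareConverges_of_le (hG : G ≤ confGroup N) (hs : 0 ≤ s)
    (hζ : PoincareConverges G ζ s) (hz : z ∈ hypBall N) : PoincareConverges G z s := by
  refine Summable.of_nonneg_of_le
    (fun g => Real.rpow_nonneg (confDeriv_pos (hG g.2) z).le s) (fun g => ?_)
    (Summable.mul_left ((4 / (1 - ‖(z : Euc N)‖) ^ 2) ^ s) hζ)
  rw [← Real.mul_rpow (by positivity) (confDeriv_pos (hG g.2) ζ).le]
  exact Real.rpow_le_rpow (confDeriv_pos (hG g.2) z).le (confDeriv_le_of_mem_hypBall (hG g.2) hz ζ)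
    hs

/-- Reindex the sum by `h ↦ g h` and apply the chain rule for `confDeriv`; this holds term by term.
-/
theorem orbitMeasure_image (hG : G ≤ confGroup N) {g : ClosedUnitBall N ≃ₜ ClosedUnitBall N}
    (hg : g ∈ G) {A : Set (ClosedUnitBall N)} (hA : MeasurableSet A) :
    orbitMeasure G s z (g '' A) =
      ∫⁻ x in A, ENNReal.ofReal (confDeriv g x ^ s) ∂(orbitMeasure G s z) := by
  have hgA : MeasurableSet (g '' A) := g.measurableEmbedding.measurableSet_image.2 hA
  rw [orbitMeasure_eq, Measure.smul_apply, Measure.restrict_smul, lintegral_smul_measure]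
  congr 1
  rw [← lintegral_indicator hA, lintegral_orbitSum, orbitSum_apply hgA,
    ← (Equiv.mulLeft (⟨g, hg⟩ : G)).tsum_eq]
  refine tsum_congr fun h => ?_
  have e : ((Equiv.mulLeft (⟨g, hg⟩ : G) h : G) : ClosedUnitBall N ≃ₜ ClosedUnitBall N) =
    g * (h : ClosedUnitBall N ≃ₜ ClosedUnitBall N) := rfl
  have e2 : (g * (h : ClosedUnitBall N ≃ₜ ClosedUnitBall N)) z =
    g ((h : ClosedUnitBall N ≃ₜ ClosedUnitBall N) z) := rfl
  rw [e, e2, confDeriv_mul (hG hg) (hG h.2),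
    Real.mul_rpow (confDeriv_pos (hG hg) _).le (confDeriv_pos (hG h.2) _).le,
    ENNReal.ofReal_mul (Real.rpow_nonneg (confDeriv_pos (hG hg) _).le s)]
  by_cases hx : (h : ClosedUnitBall N ≃ₜ ClosedUnitBall N) z ∈ A
  · rw [Set.indicator_of_mem (Set.mem_image_of_mem g hx), Set.indicator_of_mem hx, Pi.one_apply,
      mul_one, mul_comm]
  · rw [Set.indicator_of_notMem (by rwa [g.injective.mem_set_image]), Set.indicator_of_notMem hx,
      mul_zero, mul_zero]

/-- A summable family has countable support, and all terms here are positive, so the group itself is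
countable. -/
theorem countable_groupOrbit (hG : G ≤ confGroup N) (h : PoincareConverges G z s) :
    (groupOrbit G z).Countable := by
  have h1 := h.countable_support
  have h2 : Function.support (fun g : G =>
      confDeriv (g : ClosedUnitBall N ≃ₜ ClosedUnitBall N) z ^ s) = Set.univ :=
    Set.eq_univ_of_forall fun g => (Real.rpow_pos_of_pos (confDeriv_pos (hG g.2) z) s).ne'
  rw [h2, Set.countable_univ_iff] at h1
  refine (Set.countable_range fun g : G =>
    (g : ClosedUnitBall N ≃ₜ ClosedUnitBall N) z).mono ?_
  rintro _ ⟨g, hg, rfl⟩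
  exact ⟨⟨g, hg⟩, rfl⟩

theorem orbitMeasure_compl_groupOrbit (hG : G ≤ confGroup N) (h : PoincareConverges G z s) :
    orbitMeasure G s z (groupOrbit G z)ᶜ = 0 := by
  rw [orbitMeasure_eq, Measure.smul_apply,
    orbitSum_apply (countable_groupOrbit hG h).measurableSet.compl, smul_eq_mul]
  refine mul_eq_zero_of_right _ (ENNReal.tsum_eq_zero.2 fun g => ?_)
  rw [Set.indicator_of_notMem, mul_zero]
  exact fun hn => hn ⟨g, g.2, rfl⟩

theorem orbitMeasure_singleton_pos (hG : G ≤ confGroup N) (h : PoincareConverges G z s)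
    {x : ClosedUnitBall N} (hx : x ∈ groupOrbit G z) : 0 < orbitMeasure G s z {x} := by
  obtain ⟨g, hg, rfl⟩ := hx
  rw [orbitMeasure_eq, Measure.smul_apply, orbitSum_apply (measurableSet_singleton _), smul_eq_mul]
  refine ENNReal.mul_pos (ENNReal.inv_ne_zero.2 (orbitSum_univ_ne_top hG h)) ?_
  refine (lt_of_lt_of_le ?_ (ENNReal.le_tsum (⟨g, hg⟩ : G))).ne'
  simpa using Real.rpow_pos_of_pos (confDeriv_pos (hG hg) z) s

theorem isPurelyAtomic_of_support {X : Type*} [MeasurableSpace X] {μ : Measure X} {O : Set X}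
    (h0 : μ Oᶜ = 0) (hpos : ∀ x ∈ O, 0 < μ {x}) : IsPurelyAtomic μ := by
  intro A _ hA
  by_contra! hne
  have hsub : A ⊆ Oᶜ := fun x hx hxO => (hpos x hxO).not_ge (hne x hx)
  exact hA.ne' (measure_mono_null hsub h0)

/-- The orbit measures converge along the whole ending sequence, so uniqueness of weak limits leaves
a single candidate, independent of `w`, `z` and the subsequence. -/
theorem IsEndingMeasure.eq_orbitMeasure (hG : G ≤ confGroup N) (hs : 0 ≤ s)
    (hζ : ζ ∈ bdSphere N) (hconv : PoincareConverges G ζ s) {μ : Measure (ClosedUnitBall N)}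
    (hμ : IsEndingMeasure G s ζ μ) : μ = orbitMeasure G s ζ := by
  obtain ⟨hP, hprob, w, z, hw, hz, k, hk, hlim⟩ := hμ
  obtain ⟨K, hK, hdom⟩ := hz.exists_confDeriv_le hG hw.1 hζ
  have := isProbabilityMeasure_orbitMeasure hG hconv
  refine ext_of_forall_integral_eq_of_IsFiniteMeasure fun f => ?_
  refine tendsto_nhds_unique (hlim f.toContinuousMap) ?_
  exact (tendsto_integral_orbitMeasure hG hs hconv (fun n => hP _ (hz.1 n).1) hz.2.2 hK.le hdom
    f.toContinuousMap).comp hk.tendsto_atTop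

/-- Existence needs no compactness: the integer points of the ray provided by `jorgensenSet` form an
ending sequence, and no subsequence has to be extracted. -/
theorem isEndingMeasure_orbitMeasure (hG : G ≤ confGroup N) (hs : 0 ≤ s)
    (hζ : ζ ∈ jorgensenSet G) (hconv : PoincareConverges G ζ s) :
    IsEndingMeasure G s ζ (orbitMeasure G s ζ) := by
  obtain ⟨-, w, hw, γ, hγ, hmem⟩ := hζ
  have hP : ∀ z ∈ hypBall N, PoincareConverges G z s :=
    fun z hz => poincareConverges_of_le hG hs hconv hz
  have hz : IsEndingSequence G w ζ fun n : ℕ => γ n := by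
    refine ⟨fun n => hmem n n.cast_nonneg, ⟨γ, hγ, hmem, 0, fun n => ⟨n, n.cast_nonneg, ?_⟩⟩,
      hγ.2.2.2.comp tendsto_natCast_atTop_atTop⟩
    simp [hypDist]
  obtain ⟨K, hK, hdom⟩ := hz.exists_confDeriv_le hG hw.1 hγ.2.2.1
  exact ⟨hP, isProbabilityMeasure_orbitMeasure hG hconv, w, _, hw, hz, id, strictMono_id,
    tendsto_integral_orbitMeasure hG hs hconv (fun n => hP _ (hz.1 n).1) hz.2.2 hK.le hdom⟩

end OrbitMeasure

theorem mainTheorem10 (N : ℕ) (hN : 1 ≤ N) (s : ℝ) (hs : 0 < s) (φ : ℕ → ℝ)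
    (hφ_two : ∀ n, 2 ≤ φ n) (hφ_mono : Monotone φ)
    (hφ_summable : Summable fun n => (4 / φ n) ^ (2 * s))
    (hφ_sum : ∑' n, (4 / φ n) ^ (2 * s) < 1 / 2)
    (S : SchottkyData N φ) (ζ : ClosedUnitBall N) (hζ : ζ ∈ S.jorgensenSet') :
    PoincareConverges S.group ζ s ∧
    (∃ μ, IsEndingMeasure S.group s ζ μ) ∧
    ∀ μ, IsEndingMeasure S.group s ζ μ →
      IsConformalMeasure S.group s μ ∧ IsPurelyAtomic μ ∧
      μ (groupOrbit S.group ζ)ᶜ = 0 ∧ ∀ x ∈ groupOrbit S.group ζ, 0 < μ {x} := by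
  have hext : ∀ n ε, ζ ∈ bdExt (S.centre n ε) (φ n * S.radius n) := by
    simpa only [Set.mem_iInter] using hζ.2
  have hbd : ζ ∈ bdSphere N := (hext 0 true).1
  have hconv : PoincareConverges S.group ζ s :=
    S.poincareConverges hN hs hφ_two hφ_summable hφ_sum hbd fun n ε => (hext n ε).2.le
  refine ⟨hconv, ⟨_, isEndingMeasure_orbitMeasure S.group_le hs.le hζ.1 hconv⟩, ?_⟩
  intro μ hμ
  obtain rfl := hμ.eq_orbitMeasure S.group_le hs.le hbd hconv
  have h0 := orbitMeasure_compl_groupOrbit S.group_le hconv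
  have hpos : ∀ x ∈ groupOrbit S.group ζ, 0 < orbitMeasure S.group s ζ {x} :=
    fun x hx => orbitMeasure_singleton_pos S.group_le hconv hx
  exact ⟨⟨isProbabilityMeasure_orbitMeasure S.group_le hconv,
    fun g hg A hA => orbitMeasure_image S.group_le hg hA⟩,
    isPurelyAtomic_of_support h0 hpos, h0, hpos⟩
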